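/- **Setting.** Let $S$ be a Lusin space, i.e. a topological space homeomorphic to a Borel subset of a Polish space. An $S$-valued *filtered random variable* is a tuple $\mathbb X=(\Omega,\mathcal F,\mathbb P,(\mathcal F_t)_{t\in[0,1]},X)$ consisting of a probability space, a right-continuous complete filtration and an $\mathcal F_1$-measurable $X:\Omega\to S$. For a topological space $E$, let $\mathcal P(E)$ be the space of Borel probability measures on $E$ with the weak topology, $\delta:E\to\mathcal P(E)$, $x\mapsto\delta_x$, and $D(E)$ the space of càdlàg functions $[0,1]\to E$ with the topology of convergence in measure with respect to $\lambda=\frac12(\mathrm{Leb}+\delta_1)$. Put $$M_0=S,\qquad M_{n+1}=\{f\in D(\mathcal P(M_n)): f(1)\in\delta(M_n)\},\qquad M_\infty=\Big\{f\in D\Big(\prod_{n=0}^\infty\mathcal P(M_n)\Big): f(1)\in\prod_{n=0}^\infty\delta(M_n)\Big\}.$$ The *prediction processes* of $\mathbb X$ are $\mathrm{pp}^0(\mathbb X)=X$ and, inductively, $\mathrm{pp}^{n+1}(\mathbb X)$ the ($M_{n+1}$-valued, up to indistinguishability unique) càdlàg version of $(\mathcal L(\mathrm{pp}^n(\mathbb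 X)\mid\mathcal F_t))_{t\in[0,1]}$; moreover $\mathrm{pp}^\infty_t(\mathbb X)=(\mathrm{pp}^1_t(\mathbb X),\mathrm{pp}^2_t(\mathbb X),\dots)$, which defines an $M_\infty$-valued random variable. *Adapted functions* are the formal terms built by the following rules; each term $f$ has a rank, a finite time set $T(f)\subseteq[0,1]$, and a value $f(\mathbb X)$, which is a random variable on the probability space of $\mathbb X$: 1. every $f\in C_b(S)$ is an adapted function, of rank $0$, with $T(f)=\emptyset$ and $f(\mathbb X)=f(X)$; 2. if $m\ge1$, $f_1,\dots,f_m$ are adapted functions and $g\in C_b(\mathbb R^m)$, then $g(f_1,\dots,f_m)$ is an adapted function, of rank $\max_i\operatorname{rank}(f_i)$, with $T(g(f_1,\dots,f_m))=\bigcup_iT(f_i)$ and value $g(f_1(\mathbb X),\dots,f_m(\mathbb X))$; 3. if $f$ is an adapted function and $t\in[0,1]$, then $(f|t)$ is an adapted function, of rank $\operatorname{rank}(f)+1$, with $T((f|t))=T(f)\cup\{t\}$ and value $\mathbb E[f(\mathbb X)\mid\mathcal F_t]$. **Proposition.** Let $n\in\{0,1,2,\dots\}\cup\{\infty\}$ and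 let $\mathbb X,\mathbb Y$ be $S$-valued filtered random variables (possibly on different probability spaces). The following are equivalent: (i) $\mathcal L(\mathrm{pp}^n(\mathbb X))=\mathcal L(\mathrm{pp}^n(\mathbb Y))$ as Borel probability measures on $M_n$; (ii) $\mathbb E[f(\mathbb X)]=\mathbb E[f(\mathbb Y)]$ for all adapted functions $f$ of rank at most $n$; (iii) there exists a dense set $T\subseteq[0,1]$ with $1\in T$ such that $\mathbb E[f(\mathbb X)]=\mathbb E[f(\mathbb Y)]$ for all adapted functions $f$ of rank at most $n$ with $T(f)\subseteq T$. Moreover, for every dense set $T\subseteq[0,1]$ with $1\in T$, (i) holds if and only if $\mathbb E[f(\mathbb X)]=\mathbb E[f(\mathbb Y)]$ for all adapted functions $f$ of rank at most $n$ with $T(f)\subseteq T$. -/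

import Mathlib

open MeasureTheory Filter Topology Set
open scoped unitInterval BoundedContinuousFunction ENNReal

universe u v w

/-- A Lusin space: a topological space homeomorphic to a Borel subset of a Polish space. -/
class LusinSpace (S : Type u) [TopologicalSpace S] : Prop where
  exists_embedding : ∃ (S' : Type u) (_ : TopologicalSpace S') (_ : PolishSpace S') (ι : S → S'),
    IsEmbedding ι ∧ MeasurableSet[borel S'] (range ι)

/-! ### Càdlàg paths on `[0,1]` with the Meyer–Zheng topology -/

/-- Right-continuous with left limits. (At `t = 1` right-continuity and at `t = 0` existence of a
left limit are automatic.) -/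
def IsCadlag {E : Type u} [TopologicalSpace E] (f : I → E) : Prop :=
  (∀ t, ContinuousWithinAt f (Ici t) t) ∧ ∀ t, ∃ x, Tendsto f (𝓝[<] t) (𝓝 x)

/-- The space `D(E)` of càdlàg functions `[0,1] → E`. -/
def CadlagPath (E : Type u) [TopologicalSpace E] : Type u := {f : I → E // IsCadlag f}

/-- The measure `λ = (Leb + δ₁) / 2` on `[0,1]`. -/
noncomputable def mzMeasure : Measure I := (2⁻¹ : ℝ≥0∞) • (volume + Measure.dirac 1)

/-- The Meyer–Zheng topology on `D(E)`: the topology of convergence in `λ`-measure with respect to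
the metrics `m` that are compatible with the topology of `E`. (For separable metrizable `E` every
compatible metric yields the same topology.) -/
instance CadlagPath.instTopologicalSpace (E : Type u) [τ : TopologicalSpace E] :
    TopologicalSpace (CadlagPath E) :=
  TopologicalSpace.generateFrom
    {U | ∃ m : MetricSpace E, m.toUniformSpace.toTopologicalSpace = τ ∧
      ∃ (f : CadlagPath E) (ε : ℝ) (δ : ℝ≥0∞), 0 < ε ∧ 0 < δ ∧
        U = {g : CadlagPath E | mzMeasure {t | ε ≤ m.dist (f.1 t) (g.1 t)} < δ}}

instance CadlagPath.instMeasurableSpace (E : Type u) [TopologicalSpace E] :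
    MeasurableSpace (CadlagPath E) := borel _

instance CadlagPath.instBorelSpace (E : Type u) [TopologicalSpace E] :
    BorelSpace (CadlagPath E) := ⟨rfl⟩

theorem isCadlag_const {E : Type u} [TopologicalSpace E] (x : E) : IsCadlag (fun _ : I => x) :=
  ⟨fun _ => continuousWithinAt_const, fun _ => ⟨x, tendsto_const_nhds⟩⟩

theorem isCadlag_pi {ι : Type v} {E : ι → Type u} [∀ i, TopologicalSpace (E i)]
    {f : I → ∀ i, E i} (hf : ∀ i, IsCadlag (fun t => f t i)) : IsCadlag f := by
  refine ⟨fun t => tendsto_pi_nhds.2 fun i => (hf i).1 t, fun t => ?_⟩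
  choose x hx using fun i => (hf i).2 t
  exact ⟨x, tendsto_pi_nhds.2 hx⟩

/-! ### Path spaces of the iterated prediction processes -/

/-- The paths `f ∈ D(𝒫(E))` that terminate in a Dirac measure, `f(1) ∈ δ(E)`, as a subspace of
`D(𝒫(E))`; here `𝒫(E)` carries the weak topology. -/
abbrev PredPath (E : Type u) [TopologicalSpace E] [MeasurableSpace E] [BorelSpace E] : Type u :=
  {f : CadlagPath (ProbabilityMeasure E) // f.1 1 ∈ range (diracProba : E → ProbabilityMeasure E)}

/-- The constant path `t ↦ δ_x`. -/
noncomputable def PredPath.const {E : Type u} [TopologicalSpace E] [MeasurableSpace E]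
    [BorelSpace E] (x : E) : PredPath E :=
  ⟨⟨fun _ => diracProba x, isCadlag_const _⟩, x, rfl⟩

/-- A topological space bundled with its Borel `σ`-algebra. -/
structure BorelTop : Type (u + 1) where
  carrier : Type u
  [top : TopologicalSpace carrier]
  [meas : MeasurableSpace carrier]
  [borel : BorelSpace carrier]

instance : CoeSort BorelTop (Type u) := ⟨BorelTop.carrier⟩

attribute [instance] BorelTop.top BorelTop.meas BorelTop.borel

/-- The spaces `M_0 = S`, `M_{n+1} = {f ∈ D(𝒫(M_n)) : f(1) ∈ δ(M_n)}`. -/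
noncomputable def predSpace (S : Type u) [TopologicalSpace S] [MeasurableSpace S] [BorelSpace S] :
    ℕ → BorelTop.{u}
  | 0 => ⟨S⟩
  | n + 1 => ⟨PredPath (predSpace S n)⟩

/-- The space `M_∞ = {f ∈ D(∏_{n ≥ 0} 𝒫(M_n)) : f(1) ∈ ∏_{n ≥ 0} δ(M_n)}`. -/
abbrev PredPathInfty (S : Type u) [TopologicalSpace S] [MeasurableSpace S] [BorelSpace S] :
    Type u :=
  {f : CadlagPath (∀ n : ℕ, ProbabilityMeasure (predSpace S n)) //
    ∀ n, f.1 1 n ∈ range (diracProba : predSpace S n → ProbabilityMeasure (predSpace S n))}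

/-- The spaces `M_n` for `0 ≤ n ≤ ∞`. -/
noncomputable def predSpaceENat (S : Type u) [TopologicalSpace S] [MeasurableSpace S]
    [BorelSpace S] : ℕ∞ → BorelTop.{u}
  | none => ⟨PredPathInfty S⟩
  | some n => predSpace S n

/-! ### Filtered random variables and their prediction processes -/

/-- An `S`-valued filtered random variable in continuous time: a probability space with a
right-continuous complete filtration `(ℱ_t)_{t ∈ [0,1]}` and an `ℱ_1`-measurable random
variable `X`. -/
structure FilteredRV (S : Type u) [TopologicalSpace S] [MeasurableSpace S] [BorelSpace S] :
    Type (max u (v + 1)) where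
  Ω : Type v
  [mΩ : MeasurableSpace Ω]
  P : Measure Ω
  [isProb : IsProbabilityMeasure P]
  ℱ : Filtration I mΩ
  rightCont : ℱ.IsRightContinuous
  complete : ∀ (t : I) (s : Set Ω), P s = 0 → MeasurableSet[ℱ t] s
  X : Ω → S
  measurable_X : Measurable[ℱ 1] X

namespace FilteredRV

attribute [instance] FilteredRV.mΩ FilteredRV.isProb

variable {S : Type u} [TopologicalSpace S] [MeasurableSpace S] [BorelSpace S]

/-- `Z` is a càdlàg version of `(ℒ(Y | ℱ_t))_{t ∈ [0,1]}` with paths in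
`{f ∈ D(𝒫(E)) : f(1) ∈ δ(E)}`: it is a random variable with values in this path space, adapted,
and `Z_t` is a regular conditional law of `Y` given `ℱ_t`, for each `t`. -/
structure IsPredProc (𝕏 : FilteredRV.{u, v} S) {E : Type u} [TopologicalSpace E]
    [MeasurableSpace E] [BorelSpace E] (Y : 𝕏.Ω → E) (Z : 𝕏.Ω → PredPath E) : Prop where
  measurable : Measurable[𝕏.ℱ 1] Z
  adapted : ∀ t : I, Measurable[𝕏.ℱ t, borel (ProbabilityMeasure E)] fun ω => (Z ω).1.1 t
  condLaw : ∀ (t : I) (B : Set E), MeasurableSet B →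
    (fun ω => ((Z ω).1.1 t : Measure E).real B) =ᵐ[𝕏.P]
      𝕏.P[(Y ⁻¹' B).indicator (fun _ => (1 : ℝ)) | 𝕏.ℱ t]

open Classical in
/-- The prediction process of `Y` (a càdlàg version of `(ℒ(Y | ℱ_t))_t`, unique up to
indistinguishability). The second branch is a default value, only there to make the
definition total. -/
noncomputable def predProc (𝕏 : FilteredRV.{u, v} S) {E : Type u} [TopologicalSpace E]
    [MeasurableSpace E] [BorelSpace E] (Y : 𝕏.Ω → E) : 𝕏.Ω → PredPath E :=
  if h : ∃ Z, 𝕏.IsPredProc Y Z then h.choose else fun ω => PredPath.const (Y ω)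

/-- The iterated prediction processes `pp^0 = X`, `pp^{n+1} = pp(pp^n)`. -/
noncomputable def pp (𝕏 : FilteredRV.{u, v} S) : (n : ℕ) → 𝕏.Ω → predSpace S n
  | 0 => 𝕏.X
  | n + 1 => 𝕏.predProc (𝕏.pp n)

/-- The path of `pp^{n+1}`, as an element of `{f ∈ D(𝒫(M_n)) : f(1) ∈ δ(M_n)} = M_{n+1}`. -/
noncomputable def ppPath (𝕏 : FilteredRV.{u, v} S) (n : ℕ) (ω : 𝕏.Ω) : PredPath (predSpace S n) :=
  𝕏.pp (n + 1) ω

/-- The prediction process of order `∞`, `pp^∞_t = (pp^1_t, pp^2_t, …)`. -/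
noncomputable def ppInfty (𝕏 : FilteredRV.{u, v} S) (ω : 𝕏.Ω) : PredPathInfty S :=
  ⟨⟨fun t n => (𝕏.ppPath n ω).1.1 t, isCadlag_pi fun n => (𝕏.ppPath n ω).1.2⟩,
    fun n => (𝕏.ppPath n ω).2⟩

/-- `pp^n` for `0 ≤ n ≤ ∞`. -/
noncomputable def ppENat (𝕏 : FilteredRV.{u, v} S) : (n : ℕ∞) → 𝕏.Ω → predSpaceENat S n
  | none => 𝕏.ppInfty
  | some n => 𝕏.pp n

/-- The law of `pp^n` on the Borel sets of `M_n`, for `0 ≤ n ≤ ∞`. -/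
noncomputable def ppLaw (𝕏 : FilteredRV.{u, v} S) (n : ℕ∞) : Measure (predSpaceENat S n) :=
  𝕏.P.map (𝕏.ppENat n)

end FilteredRV

/-! ### Adapted functions -/

/-- Adapted functions, as terms: `f ∈ C_b(S)`; `g(f_1, …, f_m)` with `m ≥ 1` and `g ∈ C_b(ℝ^m)`;
`(f | t)` with `t ∈ [0,1]`. (In `comp`, the arity is `m + 1`.) -/
inductive AdaptedFun (S : Type u) [TopologicalSpace S] : Type u
  | base (f : S →ᵇ ℝ) : AdaptedFun S
  | comp (m : ℕ) (g : (Fin (m + 1) → ℝ) →ᵇ ℝ) (f : Fin (m + 1) → AdaptedFun S) : AdaptedFun S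
  | cond (f : AdaptedFun S) (t : I) : AdaptedFun S

namespace AdaptedFun

/-- The rank of an adapted function. -/
def rank {S : Type u} [TopologicalSpace S] : AdaptedFun S → ℕ
  | base _ => 0
  | comp _ _ f => Finset.univ.sup fun i => (f i).rank
  | cond f _ => f.rank + 1

/-- The set `T(f) ⊆ [0,1]` of times used in an adapted function. -/
def times {S : Type u} [TopologicalSpace S] : AdaptedFun S → Set I
  | base _ => ∅
  | comp _ _ f => ⋃ i, (f i).times
  | cond f t => f.times ∪ {t}

/-- The value `f(𝕏)` of an adapted function, a random variable on the probability space of `𝕏`. -/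
noncomputable def value {S : Type u} [TopologicalSpace S] [MeasurableSpace S] [BorelSpace S]
    (𝕏 : FilteredRV.{u, v} S) : AdaptedFun S → 𝕏.Ω → ℝ
  | base f => fun ω => f (𝕏.X ω)
  | comp _ g f => fun ω => g fun i => (f i).value 𝕏 ω
  | cond f t => 𝕏.P[f.value 𝕏 | 𝕏.ℱ t]

/-- The expectation `𝔼[f(𝕏)]`. -/
noncomputable def expectation {S : Type u} [TopologicalSpace S] [MeasurableSpace S] [BorelSpace S]
    (f : AdaptedFun S) (𝕏 : FilteredRV.{u, v} S) : ℝ :=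
  ∫ ω, f.value 𝕏 ω ∂𝕏.P

end AdaptedFun

/-! Conditioning on `ℱ_t` is integration against the prediction process: if `f(𝕏) = G(pp^n(𝕏))`
a.s., then `(f|t)(𝕏) = ∫ G d pp^{n+1}_t(𝕏)` a.s. Inductively, an adapted function of rank at most
`n` is a.s. a bounded measurable function of `pp^n`, the same function for `𝕏` and `𝕐`
(`AdaptedFun.exists_value_ae_eq`), so the law of `pp^n` determines all expectations.

Conversely, the functions on `M_n` that arise in this way, even from times in `T` only, are stable
under continuous operations and generate the Borel sets (`predSpace_le_generateFrom`). Indeed, path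
space is generated by the evaluations at times in `T` (`CadlagPath.measurable_of_eval`), and
`𝒫(M_n)` by the integrals of a stable generating family
(`ClosedUnderContinuous.measurable_of_integral`). A π-λ argument recovers the law
(`ClosedUnderContinuous.measure_eq`). The case `n = ∞` is treated coordinate by coordinate.

Most of the work secures the prediction processes themselves. Instead of the Lusin property of
`M_n`, the induction carries separable metrizability of `M_n` and tightness of `pp^n`. Tightness
yields regular conditional laws (`exists_isCondLaw`). Integrals of countably many test functions
embed `𝒫(E)` into the Hilbert cube, and each one turns conditional laws into a bounded martingale.
Along dyadic times Doob's maximal inequality keeps the conditional laws in a compact set, and Doob's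
upcrossing inequality bounds their oscillation (`exists_good_event`); hence right limits exist and
form a càdlàg version (`FilteredRV.exists_isPredProc`). The same bounds, with tightness of the
coordinates in `L¹`, produce compact sets of paths (`CoordEmb.isCompact_setOf_path`), so the
prediction process is tight again and the induction continues. -/

open TopologicalSpace (MetrizableSpace)

/-! ### Coordinates on separable metrizable spaces -/

theorem measurable_comp_iff_of_isEmbedding {X : Type u} {Y : Type v} [TopologicalSpace X]
    [TopologicalSpace Y] [mX : MeasurableSpace X] [hX : BorelSpace X] [mY : MeasurableSpace Y]
    [hY : BorelSpace Y] {f : X → Y} (hf : IsEmbedding f) {Ω : Type w} {mΩ : MeasurableSpace Ω}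
    {g : Ω → X} : Measurable g ↔ Measurable fun ω => f (g ω) := by
  have h1 : mX = MeasurableSpace.comap f mY := by
    rw [hX.measurable_eq, hY.measurable_eq]
    exact (congrArg (@borel X) hf.eq_induced).trans borel_comap
  rw [h1]
  exact measurable_comap_iff

/-- A countable family of `[0,1]`-valued functions that embeds `E` into the Hilbert cube. -/
structure CoordEmb {E : Type u} [TopologicalSpace E] (φ : ℕ → E → ℝ) : Prop where
  isEmbedding : IsEmbedding fun x j => φ j x
  mem_Icc : ∀ j x, φ j x ∈ Icc (0 : ℝ) 1

namespace CoordEmb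

variable {E : Type u} [TopologicalSpace E] {φ : ℕ → E → ℝ}

theorem continuous (hφ : CoordEmb φ) (j : ℕ) : Continuous (φ j) :=
  (continuous_apply j).comp hφ.isEmbedding.continuous

theorem abs_le_one (hφ : CoordEmb φ) (j : ℕ) (x : E) : |φ j x| ≤ 1 := by
  rw [abs_of_nonneg (hφ.mem_Icc j x).1]
  exact (hφ.mem_Icc j x).2

theorem metrizableSpace (hφ : CoordEmb φ) : MetrizableSpace E := hφ.isEmbedding.metrizableSpace

theorem secondCountableTopology (hφ : CoordEmb φ) : SecondCountableTopology E :=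
  hφ.isEmbedding.secondCountableTopology

theorem tendsto_iff (hφ : CoordEmb φ) {ι : Type v} {l : Filter ι} {f : ι → E} {x : E} :
    Tendsto f l (𝓝 x) ↔ ∀ j, Tendsto (fun i => φ j (f i)) l (𝓝 (φ j x)) := by
  rw [hφ.isEmbedding.tendsto_nhds_iff, tendsto_pi_nhds]
  rfl

theorem eq_of_forall (hφ : CoordEmb φ) {x y : E} (h : ∀ j, φ j x = φ j y) : x = y :=
  hφ.isEmbedding.injective (funext h)

/-- In a compact set, convergence of all coordinates implies convergence. -/
theorem exists_tendsto (hφ : CoordEmb φ) {K : Set E} (hK : IsCompact K) {ι : Type v}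
    {l : Filter ι} [l.NeBot] {f : ι → E} (hf : ∀ᶠ i in l, f i ∈ K) {c : ℕ → ℝ}
    (hc : ∀ j, Tendsto (fun i => φ j (f i)) l (𝓝 (c j))) :
    ∃ x ∈ K, Tendsto f l (𝓝 x) ∧ ∀ j, φ j x = c j := by
  have hK' : IsClosed ((fun x j => φ j x) '' K) :=
    (hK.image hφ.isEmbedding.continuous).isClosed
  have hlim : Tendsto (fun i j => φ j (f i)) l (𝓝 c) := tendsto_pi_nhds.2 hc
  obtain ⟨x, hxK, hx⟩ := hK'.mem_of_tendsto hlim (hf.mono fun i hi => ⟨f i, hi, rfl⟩)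
  refine ⟨x, hxK, hφ.tendsto_iff.2 fun j => ?_, fun j => congrFun hx j⟩
  have := hc j
  rwa [← congrFun hx j] at this

theorem measurable_iff (hφ : CoordEmb φ) [MeasurableSpace E] [BorelSpace E]
    {Ω : Type v} {mΩ : MeasurableSpace Ω} {f : Ω → E} :
    Measurable f ↔ ∀ j, Measurable fun ω => φ j (f ω) := by
  rw [measurable_comp_iff_of_isEmbedding hφ.isEmbedding, measurable_pi_iff]

end CoordEmb

/-! ### Countably many coordinates for the weak topology on `𝒫(E)`. -/

section ProbabilityMeasure

variable (E : Type u) [TopologicalSpace E] [MetrizableSpace E] [SecondCountableTopology E]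
  [MeasurableSpace E] [BorelSpace E]

/-- The test functions are continuous approximations from above to indicators of complements of
finite unions of basic open sets. Every closed set is a directed intersection of such complements,
so convergence of the integrals gives the limsup condition of the portmanteau theorem. -/
theorem exists_coordEmb_probabilityMeasure :
    ∃ ψ : ℕ → (E →ᵇ ℝ), (∀ j x, ψ j x ∈ Icc (0 : ℝ) 1) ∧
      CoordEmb fun j (μ : ProbabilityMeasure E) => ∫ x, ψ j x ∂(μ : Measure E) := by
  let B := TopologicalSpace.countableBasis E
  have hB := TopologicalSpace.isBasis_countableBasis E
  have : Countable B := (TopologicalSpace.countable_countableBasis E).to_subtype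
  let F : Finset B → Set E := fun s => (⋃ V ∈ s, (V : Set E))ᶜ
  have hF : ∀ s, IsClosed (F s) := fun s =>
    (isOpen_biUnion fun V _ => hB.isOpen V.2).isClosed_compl
  obtain ⟨e, he⟩ := exists_surjective_nat (Finset B × ℕ)
  let a : ℕ → (E →ᵇ NNReal) := fun j => (hF (e j).1).apprSeq (e j).2
  have ha : ∀ j x, a j x ≤ 1 := fun j x => HasOuterApproxClosed.apprSeq_apply_le_one _ _ _
  let ψ : ℕ → (E →ᵇ ℝ) := fun j =>
    BoundedContinuousFunction.comp ((↑) : NNReal → ℝ) NNReal.isometry_coe.lipschitz (a j)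
  have hψa : ∀ j x, ψ j x = a j x := fun _ _ => rfl
  have hint : ∀ j (μ : ProbabilityMeasure E),
      ∫ x, ψ j x ∂(μ : Measure E) = (∫⁻ x, a j x ∂(μ : Measure E)).toReal := fun j μ => by
    rw [integral_eq_lintegral_of_nonneg_ae (ae_of_all _ fun x => (hψa j x).symm ▸ (a j x).2)
      (ψ j).continuous.aestronglyMeasurable]
    simp [hψa]
  have hfin : ∀ j (μ : ProbabilityMeasure E), ∫⁻ x, a j x ∂(μ : Measure E) ≤ 1 := fun j μ => by
    calc ∫⁻ x, a j x ∂(μ : Measure E) ≤ ∫⁻ _, 1 ∂(μ : Measure E) :=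
          lintegral_mono fun x => ENNReal.coe_le_one_iff.2 (ha j x)
      _ = 1 := by simp
  have hcont : Continuous fun (μ : ProbabilityMeasure E) j => ∫ x, ψ j x ∂(μ : Measure E) :=
    continuous_pi fun j =>
      ProbabilityMeasure.continuous_integral_boundedContinuousFunction (ψ j)
  have hind : IsInducing fun (μ : ProbabilityMeasure E) j => ∫ x, ψ j x ∂(μ : Measure E) := by
    refine isInducing_iff_nhds.2 fun μ => le_antisymm (hcont.tendsto μ).le_comap ?_
    refine tendsto_id'.1 (tendsto_of_forall_isClosed_limsup_le' fun C hC => ?_)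
    let D := {V : B // (V : Set E) ⊆ Cᶜ}
    let G : Finset D → Set E := fun s => F (s.map (Function.Embedding.subtype _))
    have hGanti : Antitone G := by
      intro s t hst
      apply compl_subset_compl.2
      exact biUnion_subset_biUnion_left fun V hV => Finset.map_subset_map.2 hst hV
    have hG : ⋂ s, G s = C := by
      apply Subset.antisymm
      · intro x hx
        by_contra hxC
        obtain ⟨V, hV, hxV, hVC⟩ := hB.exists_subset_of_mem_open
          (show x ∈ Cᶜ from hxC) hC.isOpen_compl
        exact mem_iInter.1 hx {(⟨⟨V, hV⟩, hVC⟩ : D)}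
          (mem_biUnion (Finset.mem_map_of_mem _ (Finset.mem_singleton_self _)) hxV)
      · refine subset_iInter fun s x hx => ?_
        simp only [G, F, mem_compl_iff, mem_iUnion, not_exists]
        intro V hV hxV
        obtain ⟨W, -, rfl⟩ := Finset.mem_map.1 hV
        exact W.2 hxV hx
    -- It now suffices to bound the limsup of `ν C` by each `μ (G s)`, and `ν C ≤ ν (G s) ≤ ∫ a_j dν
    -- → ∫ a_j dμ`, which is close to `μ (G s)` for good approximations `a_j`.
    have hμC : (μ : Measure E) C = ⨅ s, (μ : Measure E) (G s) := by
      rw [← hG]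
      exact hGanti.measure_iInter (fun s => (hF _).measurableSet.nullMeasurableSet)
        ⟨∅, measure_ne_top _ _⟩
    rw [hμC]
    refine le_iInf fun s => ?_
    have hlim := HasOuterApproxClosed.tendsto_lintegral_apprSeq
      (hF (s.map (Function.Embedding.subtype _))) (μ : Measure E)
    refine ge_of_tendsto' hlim fun k => ?_
    obtain ⟨j, hj⟩ := he (s.map (Function.Embedding.subtype _), k)
    have haj : a j = (hF (s.map (Function.Embedding.subtype _))).apprSeq k := by
      simp only [a]
      rw [hj]
    rw [← haj]
    have ht : Tendsto (fun ν : ProbabilityMeasure E => ∫⁻ x, a j x ∂(ν : Measure E))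
        (comap (fun (μ : ProbabilityMeasure E) j => ∫ x, ψ j x ∂(μ : Measure E))
          (𝓝 fun j => ∫ x, ψ j x ∂(μ : Measure E))) (𝓝 (∫⁻ x, a j x ∂(μ : Measure E))) := by
      have h1 := ((continuous_apply j).tendsto _).comp (tendsto_comap
        (f := fun (μ : ProbabilityMeasure E) j => ∫ x, ψ j x ∂(μ : Measure E))
        (x := 𝓝 fun j => ∫ x, ψ j x ∂(μ : Measure E)))
      refine (ENNReal.tendsto_toReal_iff (fun ν => ((hfin j ν).trans_lt ENNReal.one_lt_top).ne)
        ((hfin j μ).trans_lt ENNReal.one_lt_top).ne).1 ?_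
      simpa only [← hint] using! h1
    have := neBot_of_le (hcont.tendsto μ).le_comap
    rw [← ht.limsup_eq]
    refine limsup_le_limsup (Eventually.of_forall fun ν => ?_)
    refine (measure_mono ?_).trans
      ((HasOuterApproxClosed.measure_le_lintegral (hF (s.map (Function.Embedding.subtype _)))
        (ν : Measure E) k).trans_eq (by rw [haj]))
    exact hG.symm.subset.trans (iInter_subset _ s)
  refine ⟨ψ, fun j x => ⟨(a j x).2, by exact_mod_cast ha j x⟩, ⟨hind, hind.injective⟩,
    fun j μ => ⟨integral_nonneg fun x => (a j x).2, ?_⟩⟩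
  rw [hint]
  exact ENNReal.toReal_le_of_le_ofReal zero_le_one (by simpa using hfin j μ)

instance instSecondCountableTopologyProbabilityMeasure :
    SecondCountableTopology (ProbabilityMeasure E) :=
  let ⟨_, _, h⟩ := exists_coordEmb_probabilityMeasure E
  h.secondCountableTopology

/-- Masses of closed sets are limits of integrals of continuous functions, hence weakly Borel, and
closed sets form a generating π-system. Conversely, the coordinates that induce the weak topology
are measurable for the `σ`-algebra generated by the masses of events. -/
instance instBorelSpaceProbabilityMeasure : BorelSpace (ProbabilityMeasure E) := by
  obtain ⟨ψ, hψ, h⟩ := exists_coordEmb_probabilityMeasure E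
  refine ⟨le_antisymm ?_ ?_⟩
  · have : @Measurable _ _ (borel _) _ fun μ : ProbabilityMeasure E => (μ : Measure E) := by
      let _ : MeasurableSpace (ProbabilityMeasure E) := borel _
      have : BorelSpace (ProbabilityMeasure E) := ⟨rfl⟩
      refine Measurable.measure_of_isPiSystem_of_isProbabilityMeasure
        (S := {s | IsClosed s}) ?_ (fun s hs t ht _ => hs.inter ht) fun C hC => ?_
      · rw [← borel_eq_generateFrom_isClosed]
        exact BorelSpace.measurable_eq
      · refine measurable_of_tendsto_metrizable (fun k => ?_) (tendsto_pi_nhds.2 fun μ =>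
          HasOuterApproxClosed.tendsto_lintegral_apprSeq hC (μ : Measure E))
        exact (ProbabilityMeasure.continuous_lintegral_boundedContinuousFunction _).measurable
    exact measurable_iff_comap_le.1 this
  · have hid : @Measurable _ _ inferInstance (borel (ProbabilityMeasure E)) id := by
      have key : ∀ j, Measurable fun μ : ProbabilityMeasure E => ∫ x, ψ j x ∂(μ : Measure E) := by
        intro j
        simp_rw [fun μ : ProbabilityMeasure E => integral_eq_lintegral_of_nonneg_ae
          (μ := (μ : Measure E)) (ae_of_all _ fun x => (hψ j x).1)
          (ψ j).continuous.aestronglyMeasurable]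
        exact ((Measure.measurable_lintegral
          (ENNReal.measurable_ofReal.comp (ψ j).continuous.measurable)).comp
          measurable_subtype_coe).ennreal_toReal
      exact (@CoordEmb.measurable_iff _ _ _ h (borel _) (@BorelSpace.mk _ _ (borel _) rfl)
      _ _ _).2 key
    exact fun s hs => hid hs

end ProbabilityMeasure

/-- Measurability into `𝒫(E)` can be tested on events. -/
theorem measurable_probabilityMeasure_iff {E : Type u} [MeasurableSpace E]
    {Ω : Type v} {mΩ : MeasurableSpace Ω} {Z : Ω → ProbabilityMeasure E} :
    Measurable Z ↔ ∀ B, MeasurableSet B → Measurable fun ω => (Z ω : Measure E) B :=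
  ⟨fun h _ hB => (Measure.measurable_coe hB).comp (measurable_subtype_coe.comp h),
    fun h => (Measure.measurable_of_measurable_coe _ h).subtype_mk⟩

/-- The coordinates of `𝒫(E)` restrict along the embedding `x ↦ δ_x`, since `∫ ψ_j dδ_x = ψ_j(x)`.
-/
theorem exists_coordEmb (E : Type u) [TopologicalSpace E] [MetrizableSpace E]
    [SecondCountableTopology E] : ∃ φ : ℕ → E → ℝ, CoordEmb φ := by
  let _ : MeasurableSpace E := borel E
  have : BorelSpace E := ⟨rfl⟩
  obtain ⟨ψ, hψ, h⟩ := exists_coordEmb_probabilityMeasure E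
  refine ⟨fun j x => ψ j x, ?_, fun j x => hψ j x⟩
  have := h.isEmbedding.comp (isEmbedding_diracProba (X := E))
  convert! this using 3 with x j
  exact (integral_dirac (fun x => ψ j x) x).symm

/-! ### The measure `λ` and dyadic grids -/

instance instIsProbabilityMeasureMzMeasure : IsProbabilityMeasure mzMeasure := by
  constructor
  simp only [mzMeasure, Measure.smul_apply, Measure.add_apply, measure_univ, smul_eq_mul]
  rw [one_add_one_eq_two, ENNReal.inv_mul_cancel two_ne_zero ENNReal.ofNat_ne_top]

theorem mzMeasure_eq_zero_iff {s : Set I} : mzMeasure s = 0 ↔ volume s = 0 ∧ (1 : I) ∉ s := by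
  simp [mzMeasure]

theorem mzMeasure_eq_zero_of_countable {s : Set I} (hs : s.Countable) (h1 : (1 : I) ∉ s) :
    mzMeasure s = 0 :=
  mzMeasure_eq_zero_iff.2 ⟨hs.measure_zero _, h1⟩

/-- For `t < 1` a right neighbourhood contains an interval; at `t = 1` the atom of `λ` takes over.
This is what lets right-continuous paths be recovered from their `λ`-a.e. classes. -/
theorem mzMeasure_pos_of_mem_nhdsGE {s : Set I} {t : I} (hs : s ∈ 𝓝[≥] t) : 0 < mzMeasure s := by
  refine pos_iff_ne_zero.2 fun h => ?_
  obtain ⟨hv, h1⟩ := mzMeasure_eq_zero_iff.1 h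
  have ht : t < 1 := lt_of_le_of_ne unitInterval.le_one' fun h =>
    h1 (h ▸ mem_of_mem_nhdsWithin self_mem_Ici hs)
  obtain ⟨u, hu, hus⟩ := (mem_nhdsGE_iff_exists_Ico_subset' ht).1 hs
  have h0 : volume (Subtype.val '' Ico t u) = 0 := by
    rw [← unitInterval.volume_apply]
    exact measure_mono_null hus hv
  have h2 : Ioo (t : ℝ) u ⊆ Subtype.val '' Ico t u := fun x hx =>
    ⟨⟨x, t.2.1.trans hx.1.le, hx.2.le.trans u.2.2⟩, ⟨hx.1.le, hx.2⟩, rfl⟩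
  have h3 := measure_mono_null h2 h0
  rw [Real.volume_Ioo, ENNReal.ofReal_eq_zero, sub_nonpos] at h3
  exact h3.not_gt hu

theorem mem_one_of_ae_mzMeasure {p : I → Prop} (h : ∀ᵐ t ∂mzMeasure, p t) : p 1 := by
  by_contra h1
  exact (mzMeasure_eq_zero_iff.1 (ae_iff.1 h)).2 h1

/-- A property that holds `λ`-a.e. holds at points arbitrarily close to the right of any point. -/
theorem frequently_nhdsGE_of_ae_mzMeasure {p : I → Prop} (h : ∀ᵐ t ∂mzMeasure, p t) (t : I) :
    ∃ᶠ s in 𝓝[≥] t, p s := fun hn =>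
  (mzMeasure_pos_of_mem_nhdsGE hn).ne' (ae_iff.1 h ▸ by simp)

theorem dense_of_ae_mzMeasure {p : I → Prop} (h : ∀ᵐ t ∂mzMeasure, p t) : Dense {t | p t} :=
  fun t => mem_closure_iff_frequently.2
    ((frequently_nhdsGE_of_ae_mzMeasure h t).filter_mono nhdsWithin_le_nhds)

/-- The point `min(i / 2^k, 1)`. -/
noncomputable def gridPt (k i : ℕ) : I := projIcc 0 1 zero_le_one ((i : ℝ) / 2 ^ k)

theorem gridPt_mono (k : ℕ) : Monotone (gridPt k) := fun i j hij =>
  monotone_projIcc _ (by gcongr)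

theorem gridPt_succ (k i : ℕ) : gridPt (k + 1) (2 * i) = gridPt k i := by
  unfold gridPt
  congr 1
  push_cast
  field_simp
  ring

/-- The dyadic points of level `k`. -/
def gridLevel (k : ℕ) : Set I := range (gridPt k)

theorem gridLevel_mono : Monotone gridLevel := by
  refine monotone_nat_of_le_succ fun k => ?_
  rintro _ ⟨i, rfl⟩
  exact ⟨2 * i, gridPt_succ k i⟩

/-- The dyadic points. -/
def dyadicPts : Set I := ⋃ k, gridLevel k

theorem countable_dyadicPts : dyadicPts.Countable :=
  countable_iUnion fun _ => countable_range _

theorem one_mem_dyadicPts : (1 : I) ∈ dyadicPts :=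
  mem_iUnion.2 ⟨0, 1, by simp [gridPt]⟩

/-- The first dyadic point of level `k` that is strictly larger than `t` (or `1`). -/
noncomputable def gridUp (k : ℕ) (t : I) : I := gridPt k (⌊(2 : ℝ) ^ k * t⌋₊ + 1)

theorem gridUp_mem (k : ℕ) (t : I) : gridUp k t ∈ dyadicPts :=
  mem_iUnion.2 ⟨k, _, rfl⟩

theorem coe_gridUp (k : ℕ) (t : I) :
    (gridUp k t : ℝ) = min (1 : ℝ) (((⌊(2 : ℝ) ^ k * t⌋₊ + 1 : ℕ) : ℝ) / 2 ^ k) := by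
  rw [gridUp, gridPt, coe_projIcc, max_eq_right]
  exact le_min zero_le_one (by positivity)

theorem lt_floor_div (k : ℕ) (t : I) : (t : ℝ) < ((⌊(2 : ℝ) ^ k * t⌋₊ + 1 : ℕ) : ℝ) / 2 ^ k := by
  rw [lt_div_iff₀ (by positivity), mul_comm]
  exact_mod_cast Nat.lt_floor_add_one ((2 : ℝ) ^ k * t)

theorem le_gridUp (k : ℕ) (t : I) : t ≤ gridUp k t := by
  rw [← Subtype.coe_le_coe, coe_gridUp]
  exact le_min t.2.2 (lt_floor_div k t).le

theorem lt_gridUp (k : ℕ) {t : I} (ht : t ≠ 1) : t < gridUp k t := by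
  rw [← Subtype.coe_lt_coe, coe_gridUp]
  exact lt_min (lt_of_le_of_ne t.2.2 fun h => ht (Subtype.ext h)) (lt_floor_div k t)

theorem tendsto_gridUp (t : I) : Tendsto (fun k => gridUp k t) atTop (𝓝[≥] t) := by
  refine tendsto_nhdsWithin_iff.2 ⟨?_, Eventually.of_forall fun k => le_gridUp k t⟩
  rw [tendsto_subtype_rng]
  have h : Tendsto (fun k : ℕ => (t : ℝ) + (1 / 2) ^ k) atTop (𝓝 (t + 0)) :=
    tendsto_const_nhds.add (tendsto_pow_atTop_nhds_zero_of_lt_one (by norm_num) (by norm_num))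
  rw [add_zero] at h
  refine tendsto_of_tendsto_of_tendsto_of_le_of_le tendsto_const_nhds h
    (fun k => Subtype.coe_le_coe.2 (le_gridUp k t)) fun k => ?_
  rw [coe_gridUp]
  refine (min_le_right _ _).trans ?_
  rw [div_le_iff₀ (by positivity), add_mul, ← mul_pow]
  have := Nat.floor_le (show 0 ≤ (2 : ℝ) ^ k * t from mul_nonneg (by positivity) t.2.1)
  push_cast
  norm_num
  linarith

theorem tendsto_gridUp_gt {t : I} (ht : t ≠ 1) : Tendsto (fun k => gridUp k t) atTop (𝓝[>] t) :=
  tendsto_nhdsWithin_iff.2 ⟨(tendsto_gridUp t).mono_right nhdsWithin_le_nhds,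
    Eventually.of_forall fun k => lt_gridUp k ht⟩

theorem dense_dyadicPts : Dense dyadicPts := fun t =>
  mem_closure_of_tendsto ((tendsto_gridUp t).mono_right nhdsWithin_le_nhds)
    (Eventually.of_forall fun k => gridUp_mem k t)

theorem measurable_floor_grid (k : ℕ) : Measurable fun t : I => ⌊(2 : ℝ) ^ k * t⌋₊ + 1 :=
  (Nat.measurable_floor.comp (measurable_const.mul measurable_subtype_coe)).add_const 1

/-- Right-continuous real functions are measurable. -/
theorem measurable_of_rightCont {g : I → ℝ} (hg : ∀ t, ContinuousWithinAt g (Ici t) t) :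
    Measurable g := by
  refine measurable_of_tendsto_metrizable (f := fun k t => g (gridUp k t)) (fun k => ?_)
    (tendsto_pi_nhds.2 fun t => (hg t).tendsto.comp (tendsto_gridUp t))
  exact (measurable_from_nat (f := fun i => g (gridPt k i))).comp (measurable_floor_grid k)

/-- Joint measurability of right-continuous processes. -/
theorem measurable_uncurry_of_rightCont {Ω : Type v} [MeasurableSpace Ω] {g : Ω → I → ℝ}
    (hg : ∀ ω t, ContinuousWithinAt (g ω) (Ici t) t) (hm : ∀ t, Measurable fun ω => g ω t) :
    Measurable fun p : Ω × I => g p.1 p.2 := by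
  refine measurable_of_tendsto_metrizable
    (f := fun k (p : Ω × I) => g p.1 (gridUp k p.2)) (fun k => ?_)
    (tendsto_pi_nhds.2 fun (p : Ω × I) => (hg p.1 p.2).tendsto.comp (tendsto_gridUp p.2))
  have : Measurable fun p : Ω × ℕ => g p.1 (gridPt k p.2) :=
    measurable_from_prod_countable_left fun i => hm (gridPt k i)
  exact this.comp (measurable_fst.prodMk ((measurable_floor_grid k).comp measurable_snd))

theorem neBot_nhdsWithin_inter_Ioi {T : Set I} (hT : Dense T) {t : I} (ht : t ≠ 1) :
    (𝓝[T ∩ Ioi t] t).NeBot := by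
  rw [← mem_closure_iff_nhdsWithin_neBot, mem_closure_iff]
  intro o ho hto
  have : (𝓝[>] t).NeBot :=
    nhdsGT_neBot_of_exists_gt ⟨1, lt_of_le_of_ne unitInterval.le_one' ht⟩
  have h1 : (o ∩ Ioi t).Nonempty :=
    nonempty_of_mem (inter_mem (mem_nhdsWithin_of_mem_nhds (ho.mem_nhds hto)) self_mem_nhdsWithin)
  obtain ⟨s, ⟨hs1, hs2⟩, hs3⟩ := hT.inter_open_nonempty _ (ho.inter isOpen_Ioi) h1
  exact ⟨s, hs1, hs3, hs2⟩

theorem neBot_nhdsWithin_inter_Iio {T : Set I} (hT : Dense T) {t : I} (ht : t ≠ 0) :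
    (𝓝[T ∩ Iio t] t).NeBot := by
  rw [← mem_closure_iff_nhdsWithin_neBot, mem_closure_iff]
  intro o ho hto
  have : (𝓝[<] t).NeBot :=
    nhdsLT_neBot_of_exists_lt ⟨0, lt_of_le_of_ne unitInterval.nonneg' ht.symm⟩
  have h1 : (o ∩ Iio t).Nonempty :=
    nonempty_of_mem (inter_mem (mem_nhdsWithin_of_mem_nhds (ho.mem_nhds hto)) self_mem_nhdsWithin)
  obtain ⟨s, ⟨hs1, hs2⟩, hs3⟩ := hT.inter_open_nonempty _ (ho.inter isOpen_Iio) h1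
  exact ⟨s, hs1, hs3, hs2⟩

/-! ### Path space as a subspace of `L¹` -/

/-- The product of `λ` with a finite measure on `ℕ` that charges every point. -/
noncomputable def coordMeasure : Measure (I × ℕ) :=
  mzMeasure.prod (Measure.count : Measure ℕ).toFinite

instance : IsFiniteMeasure coordMeasure := by
  unfold coordMeasure
  infer_instance

instance : SFinite coordMeasure := by
  unfold coordMeasure
  infer_instance

/-- The measure on `ℕ` charges every point, so its only null set is empty. -/
theorem ae_coordMeasure_iff {p : I × ℕ → Prop} :
    (∀ᵐ z ∂coordMeasure, p z) ↔ ∀ᵐ t ∂mzMeasure, ∀ j, p (t, j) := by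
  refine ⟨fun h => ?_, fun h => ?_⟩
  · filter_upwards [Measure.ae_ae_of_ae_prod h] with t ht j
    by_contra hj
    have h0 := ae_iff.1 ht
    rw [toFinite_apply_eq_zero_iff, Measure.count_eq_zero_iff] at h0
    exact h0.subset (show j ∈ {a | ¬ p (t, a)} from hj)
  · filter_upwards [Measure.quasiMeasurePreserving_fst.ae h] with z hz using hz z.2

section

variable {E : Type u} [TopologicalSpace E] {φ : ℕ → E → ℝ}

theorem CoordEmb.rightCont (hφ : CoordEmb φ) (j : ℕ) (f : CadlagPath E) (t : I) :
    ContinuousWithinAt (fun t => φ j (f.1 t)) (Ici t) t :=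
  (hφ.continuous j).continuousAt.comp_continuousWithinAt (f.2.1 t)

theorem CoordEmb.measurable_path (hφ : CoordEmb φ) (f : CadlagPath E) :
    Measurable fun p : I × ℕ => φ p.2 (f.1 p.1) :=
  measurable_from_prod_countable_left fun j => measurable_of_rightCont (hφ.rightCont j f)

theorem CoordEmb.memLp (hφ : CoordEmb φ) (f : CadlagPath E) :
    MemLp (fun p : I × ℕ => φ p.2 (f.1 p.1)) 1 coordMeasure :=
  MemLp.of_bound (hφ.measurable_path f).aestronglyMeasurable 1
    (ae_of_all _ fun p => hφ.abs_le_one p.2 _)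

/-- The coordinates of a path, as an element of `L¹`. -/
noncomputable def CoordEmb.toL1 (hφ : CoordEmb φ) (f : CadlagPath E) : Lp ℝ 1 coordMeasure :=
  (hφ.memLp f).toLp

theorem CoordEmb.coeFn_toL1 (hφ : CoordEmb φ) (f : CadlagPath E) :
    hφ.toL1 f =ᵐ[coordMeasure] fun p => φ p.2 (f.1 p.1) :=
  (hφ.memLp f).coeFn_toLp

/-- Convergence in `L¹` of the coordinates implies a.e. convergence along a subsequence. -/
theorem CoordEmb.exists_seq_of_tendsto (hφ : CoordEmb φ) {g : ℕ → CadlagPath E}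
    {x : Lp ℝ 1 coordMeasure} (h : Tendsto (fun n => hφ.toL1 (g n)) atTop (𝓝 x)) :
    ∃ ns : ℕ → ℕ, StrictMono ns ∧ ∀ᵐ t ∂mzMeasure, ∀ j,
      Tendsto (fun i => φ j ((g (ns i)).1 t)) atTop (𝓝 (x (t, j))) := by
  obtain ⟨ns, hns, h⟩ := (tendstoInMeasure_of_tendsto_Lp h).exists_seq_tendsto_ae
  refine ⟨ns, hns, ?_⟩
  have h1 : ∀ᵐ p ∂coordMeasure, ∀ n, hφ.toL1 (g n) p = φ p.2 ((g n).1 p.1) :=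
    ae_all_iff.2 fun n => hφ.coeFn_toL1 (g n)
  refine ae_coordMeasure_iff (p := fun p =>
    Tendsto (fun i => φ p.2 ((g (ns i)).1 p.1)) atTop (𝓝 (x p))) |>.1 ?_
  filter_upwards [h, h1] with p hp hp1
  simpa only [hp1] using hp

theorem CoordEmb.exists_seq_of_tendsto' (hφ : CoordEmb φ) {g : ℕ → CadlagPath E}
    {f : CadlagPath E} (h : Tendsto (fun n => hφ.toL1 (g n)) atTop (𝓝 (hφ.toL1 f))) :
    ∃ ns : ℕ → ℕ, StrictMono ns ∧ ∀ᵐ t ∂mzMeasure,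
      Tendsto (fun i => (g (ns i)).1 t) atTop (𝓝 (f.1 t)) := by
  obtain ⟨ns, hns, h⟩ := hφ.exists_seq_of_tendsto h
  refine ⟨ns, hns, ?_⟩
  filter_upwards [h, ae_coordMeasure_iff.1 (hφ.coeFn_toL1 f)] with t ht ht1
  refine hφ.tendsto_iff.2 fun j => ?_
  simpa only [ht1 j] using ht j

theorem CoordEmb.tendsto_toL1 (hφ : CoordEmb φ) {g : ℕ → CadlagPath E} {f : CadlagPath E}
    (h : ∀ᵐ t ∂mzMeasure, Tendsto (fun i => (g i).1 t) atTop (𝓝 (f.1 t))) :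
    Tendsto (fun n => hφ.toL1 (g n)) atTop (𝓝 (hφ.toL1 f)) := by
  rw [Lp.tendsto_Lp_iff_tendsto_eLpNorm']
  have h1 := tendsto_lintegral_norm_of_dominated_convergence (μ := coordMeasure)
    (F := fun n p => φ p.2 ((g n).1 p.1)) (f := fun p => φ p.2 (f.1 p.1)) (bound := fun _ => 1)
    (fun n => (hφ.measurable_path (g n)).aestronglyMeasurable)
    (hasFiniteIntegral_const (1 : ℝ)) (fun n => ae_of_all _ fun p => hφ.abs_le_one p.2 _)
    (ae_coordMeasure_iff.2 (h.mono fun t ht j => hφ.tendsto_iff.1 ht j))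
  refine h1.congr fun n => ?_
  rw [eLpNorm_one_eq_lintegral_enorm]
  refine lintegral_congr_ae ?_
  filter_upwards [hφ.coeFn_toL1 f, hφ.coeFn_toL1 (g n)] with p hp hp'
  rw [Pi.sub_apply, hp, hp', ofReal_norm]

/-- Two paths that differ at `t` stay in disjoint open sets on a right neighbourhood of `t`, which
has positive `λ`-measure. -/
theorem CadlagPath.ext_of_ae [T2Space E] {f g : CadlagPath E}
    (h : ∀ᵐ t ∂mzMeasure, f.1 t = g.1 t) : f = g := by
  refine Subtype.ext (funext fun t => ?_)
  have hfr := frequently_nhdsGE_of_ae_mzMeasure h t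
  by_contra hne
  obtain ⟨U, V, hU, hV, hfU, hgV, hUV⟩ := t2_separation hne
  refine hfr ?_
  filter_upwards [f.2.1 t (hU.mem_nhds hfU), g.2.1 t (hV.mem_nhds hgV)] with s hs1 hs2 heq
  exact disjoint_left.1 hUV hs1 (heq ▸ hs2)

theorem CoordEmb.toL1_injective (hφ : CoordEmb φ) : Function.Injective hφ.toL1 := by
  intro f g hfg
  have := hφ.metrizableSpace
  refine CadlagPath.ext_of_ae ?_
  filter_upwards [ae_coordMeasure_iff.1 (hφ.coeFn_toL1 f),
    ae_coordMeasure_iff.1 (hφ.coeFn_toL1 g)] with t h1 h2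
  exact hφ.eq_of_forall fun j => by rw [← h1 j, ← h2 j, hfg]

end

/-! ### Convergence in measure compared with `L¹`-convergence of the coordinates. -/

section

variable {E : Type u} [MetricSpace E] {φ : ℕ → E → ℝ}

theorem CadlagPath.measurable_dist (f g : CadlagPath E) :
    Measurable fun t => dist (f.1 t) (g.1 t) :=
  measurable_of_rightCont fun t => (f.2.1 t).dist (g.2.1 t)

/-- Otherwise some sequence of paths outside converges in measure to `f`, hence a.e. along a
subsequence, and dominated convergence puts its coordinates into `V`. -/
theorem CoordEmb.exists_nhds_subset (hφ : CoordEmb φ) (f : CadlagPath E)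
    {V : Set (Lp ℝ 1 coordMeasure)} (hV : V ∈ 𝓝 (hφ.toL1 f)) : ∃ k : ℕ,
    {g : CadlagPath E | mzMeasure {t | ((k : ℝ) + 1)⁻¹ ≤ dist (f.1 t) (g.1 t)} <
      ((k : ℝ≥0∞) + 1)⁻¹} ⊆ hφ.toL1 ⁻¹' V := by
  by_contra! hcon
  simp only [not_subset, mem_ofPred_eq, mem_preimage] at hcon
  choose g hg hgV using hcon
  have hmeas : TendstoInMeasure mzMeasure (fun k => (g k).1) atTop f.1 := by
    rw [tendstoInMeasure_iff_dist]
    intro ε hε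
    have h0 : Tendsto (fun k : ℕ => ((k : ℝ≥0∞) + 1)⁻¹) atTop (𝓝 0) := by
      have := (tendsto_add_atTop_iff_nat 1).2 ENNReal.tendsto_inv_nat_nhds_zero
      simpa using this
    refine tendsto_of_tendsto_of_tendsto_of_le_of_le' tendsto_const_nhds h0
      (Eventually.of_forall fun _ => zero_le) ?_
    have h1 := tendsto_one_div_add_atTop_nhds_zero_nat (𝕜 := ℝ)
    filter_upwards [h1.eventually (gt_mem_nhds hε)] with k hk
    refine (measure_mono fun t ht => ?_).trans (hg k).le
    rw [one_div] at hk
    have ht' : ε ≤ dist ((g k).1 t) (f.1 t) := ht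
    rw [dist_comm] at ht'
    exact hk.le.trans ht'
  obtain ⟨ns, -, hns⟩ := hmeas.exists_seq_tendsto_ae
  have := (hφ.tendsto_toL1 (g := fun i => g (ns i)) hns).eventually hV
  obtain ⟨i, hi⟩ := this.exists
  exact hgV _ hi

/-- Shows that the generating sets of the Meyer–Zheng topology are open for the `L¹`-topology.
Otherwise a sequence outside the set converges a.e. to `g`; the limsup of its sets `{ε ≤ dist}` has
measure at least `δ`, but is a.e. contained in the set belonging to `g`. -/
theorem CoordEmb.mem_comap_nhds (hφ : CoordEmb φ) (f g : CadlagPath E) {ε : ℝ} {δ : ℝ≥0∞}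
    (hg : mzMeasure {t | ε ≤ dist (f.1 t) (g.1 t)} < δ) :
    {g : CadlagPath E | mzMeasure {t | ε ≤ dist (f.1 t) (g.1 t)} < δ} ∈
      comap hφ.toL1 (𝓝 (hφ.toL1 g)) := by
  by_contra hcon
  obtain ⟨y, hy, hyn⟩ := exists_seq_forall_of_frequently
    (l := comap hφ.toL1 (𝓝 (hφ.toL1 g))) (p := fun y => ¬ y ∈
      {g : CadlagPath E | mzMeasure {t | ε ≤ dist (f.1 t) (g.1 t)} < δ}) (not_eventually.1 hcon)
  obtain ⟨ns, -, hns⟩ := hφ.exists_seq_of_tendsto' (tendsto_comap_iff.1 hy)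
  let B : ℕ → Set I := fun n => ⋃ k ≥ n, {t | ε ≤ dist (f.1 t) ((y (ns k)).1 t)}
  have hBm : ∀ n, MeasurableSet (B n) := fun n => MeasurableSet.iUnion fun k =>
    MeasurableSet.iUnion fun _ => measurableSet_le measurable_const (f.measurable_dist _)
  have hBanti : Antitone B := fun n m hnm =>
    biUnion_subset_biUnion_left fun k hk => le_trans hnm hk
  have hlim := tendsto_measure_iInter_atTop (μ := mzMeasure)
    (fun n => (hBm n).nullMeasurableSet) hBanti ⟨0, measure_ne_top _ _⟩
  have h1 : δ ≤ mzMeasure (⋂ n, B n) := ge_of_tendsto' hlim fun n => by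
    refine (not_lt.1 (hyn (ns n))).trans (measure_mono ?_)
    exact subset_biUnion_of_mem (u := fun k => {t | ε ≤ dist (f.1 t) ((y (ns k)).1 t)})
      (le_refl n)
  refine (h1.trans (measure_mono_ae ?_)).not_gt hg
  filter_upwards [hns] with t ht htB
  by_contra hlt
  have h2 : Tendsto (fun i => dist (f.1 t) ((y (ns i)).1 t)) atTop (𝓝 (dist (f.1 t) (g.1 t))) :=
    tendsto_const_nhds.dist ht
  obtain ⟨n, hn⟩ := eventually_atTop.1 (h2.eventually (gt_mem_nhds (not_le.1 hlt)))
  obtain ⟨k, hk⟩ := mem_iUnion.1 (mem_iInter.1 htB n)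
  obtain ⟨hkn, hk⟩ := mem_iUnion.1 hk
  exact (hn k hkn).not_ge hk

end

section

variable {E : Type u} [τ : TopologicalSpace E] {φ : ℕ → E → ℝ}

/-- The Meyer–Zheng topology is the `L¹`-topology of the coordinates. -/
theorem CoordEmb.isEmbedding_toL1 (hφ : CoordEmb φ) : IsEmbedding hφ.toL1 := by
  refine ⟨⟨le_antisymm ?_ ?_⟩, hφ.toL1_injective⟩
  · refine continuous_iff_le_induced.1 (continuous_iff_continuousAt.2 fun f V hV => mem_map.2 ?_)
    have := hφ.metrizableSpace
    -- One compatible metric suffices for this inclusion; the other one treats every compatible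
    -- metric.
    let m : MetricSpace E := TopologicalSpace.metrizableSpaceMetric E
    obtain ⟨k, hk⟩ := hφ.exists_nhds_subset f hV
    refine mem_of_superset (IsOpen.mem_nhds ?_ ?_) hk
    · exact TopologicalSpace.isOpen_generateFrom_of_mem
        ⟨m, rfl, f, _, _, by positivity, by simp, rfl⟩
    · have : {t : I | ((k : ℝ) + 1)⁻¹ ≤ dist (f.1 t) (f.1 t)} = ∅ := by
        ext t
        simp only [dist_self, mem_ofPred_eq, mem_empty_iff_false, iff_false, not_le]
        positivity
      rw [mem_ofPred_eq, this, measure_empty]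
      simp
  · refine le_generateFrom ?_
    rintro _ ⟨m, hm, f, ε, δ, hε, hδ, rfl⟩
    subst hm
    let _ := TopologicalSpace.induced hφ.toL1 inferInstance
    refine isOpen_iff_mem_nhds.2 fun g hg => ?_
    rw [nhds_induced]
    exact hφ.mem_comap_nhds f g hg

end

instance : SecondCountableTopology (Lp ℝ 1 coordMeasure) :=
  have : Fact ((1 : ℝ≥0∞) ≠ ⊤) := ⟨ENNReal.one_ne_top⟩
  Lp.SecondCountableTopology

section

variable (E : Type u) [TopologicalSpace E] [MetrizableSpace E] [SecondCountableTopology E]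

instance : MetrizableSpace (CadlagPath E) :=
  let ⟨_, hφ⟩ := exists_coordEmb E
  hφ.isEmbedding_toL1.metrizableSpace

instance : SecondCountableTopology (CadlagPath E) :=
  let ⟨_, hφ⟩ := exists_coordEmb E
  hφ.isEmbedding_toL1.secondCountableTopology

end

/-! ### The Borel `σ`-algebra of path space -/

section

variable {E : Type u} [TopologicalSpace E] [MetrizableSpace E] [SecondCountableTopology E]
  [MeasurableSpace E] [BorelSpace E]

/-- Evaluation need not be continuous, but by right-continuity each coordinate at `t` is a limit of
averages over shrinking right neighbourhoods of `t`, and these averages are continuous in `L¹`. At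
`t = 1` the neighbourhood is the atom `{1}`. -/
theorem CadlagPath.measurable_eval (t : I) : Measurable fun z : CadlagPath E => z.1 t := by
  obtain ⟨φ, hφ⟩ := exists_coordEmb E
  refine hφ.measurable_iff.2 fun j => ?_
  let B : ℕ → Set (I × ℕ) := fun k => (Ici t ∩ Metric.ball t ((k : ℝ) + 1)⁻¹) ×ˢ {j}
  have hBm : ∀ k, MeasurableSet (B k) := fun k =>
    (measurableSet_Ici.inter measurableSet_ball).prod (measurableSet_singleton j)
  have hB0 : ∀ k, coordMeasure (B k) ≠ 0 := fun k => by
    rw [coordMeasure, Measure.prod_prod]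
    refine mul_ne_zero (mzMeasure_pos_of_mem_nhdsGE (t := t) ?_).ne' ?_
    · exact inter_mem self_mem_nhdsWithin
        (mem_nhdsWithin_of_mem_nhds (Metric.ball_mem_nhds t (by positivity)))
    · simp [toFinite_apply_eq_zero_iff]
  have hcont : ∀ k, Measurable fun z : CadlagPath E => ⨍ p in B k, hφ.toL1 z p ∂coordMeasure := by
    intro k
    simp_rw [setAverage_eq]
    have := ((continuous_setIntegral (μ := coordMeasure) (E := ℝ) (B k)).comp
      hφ.isEmbedding_toL1.continuous).measurable
    exact this.const_smul (coordMeasure.real (B k))⁻¹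
  refine measurable_of_tendsto_metrizable hcont (tendsto_pi_nhds.2 fun z => ?_)
  refine Metric.tendsto_atTop.2 fun ε hε => ?_
  obtain ⟨δ, hδ, hδε⟩ := Metric.continuousWithinAt_iff.1 (hφ.rightCont j z t) (ε / 2) (half_pos hε)
  obtain ⟨N, hN⟩ := exists_nat_one_div_lt hδ
  refine ⟨N, fun k hk => ?_⟩
  have hmem : (⨍ p in B k, hφ.toL1 z p ∂coordMeasure) ∈
      Metric.closedBall (φ j (z.1 t)) (ε / 2) := by
    refine Convex.set_average_mem (convex_closedBall _ _) Metric.isClosed_closedBall (hB0 k)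
      (measure_ne_top _ _) ?_ (L1.integrable_coeFn _).integrableOn
    filter_upwards [ae_restrict_of_ae (hφ.coeFn_toL1 z), ae_restrict_mem (hBm k)] with p hp hpB
    obtain ⟨⟨hp1, hp2⟩, hp3⟩ := hpB
    rw [mem_singleton_iff] at hp3
    rw [hp, hp3, Metric.mem_closedBall]
    refine (hδε hp1 ((Metric.mem_ball.1 hp2).trans_le (le_trans ?_ hN.le))).le
    rw [one_div]
    gcongr
  exact (Metric.mem_closedBall.1 hmem).trans_lt (half_lt_self hε)

/-- Measurability into path space can be tested on a dense set of times containing `1`. -/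
theorem CadlagPath.measurable_of_eval {Ω : Type v} [MeasurableSpace Ω] {Z : Ω → CadlagPath E}
    {T : Set I} (hT : Dense T) (h1 : (1 : I) ∈ T)
    (h : ∀ t ∈ T, Measurable fun ω => (Z ω).1 t) : Measurable Z := by
  have hall : ∀ t, Measurable fun ω => (Z ω).1 t := fun t => by
    rcases eq_or_ne t 1 with rfl | ht
    · exact h 1 h1
    have := neBot_nhdsWithin_inter_Ioi hT ht
    obtain ⟨s, hs⟩ := exists_seq_tendsto (𝓝[T ∩ Ioi t] t)
    obtain ⟨hs1, hs2⟩ := tendsto_nhdsWithin_iff.1 hs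
    obtain ⟨N, hN⟩ := eventually_atTop.1 hs2
    refine measurable_of_tendsto_metrizable (f := fun k ω => (Z ω).1 (s (k + N)))
      (fun k => h _ (hN _ (Nat.le_add_left N k)).1) (tendsto_pi_nhds.2 fun ω => ?_)
    have hlim : Tendsto (fun k => s (k + N)) atTop (𝓝[≥] t) :=
      ((tendsto_add_atTop_iff_nat N).2 hs).mono_right
        (nhdsWithin_mono _ fun x hx => (mem_Ioi.1 hx.2).le)
    exact ((Z ω).2.1 t).tendsto.comp hlim
  obtain ⟨φ, hφ⟩ := exists_coordEmb E
  -- The `L¹`-distance to a fixed point is a parametric integral of a jointly measurable function.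
  -- Distances suffice because open sets of the separable space `L¹` are countable unions of balls.
  have key : ∀ x : Lp ℝ 1 coordMeasure, Measurable fun ω => edist (hφ.toL1 (Z ω)) x := by
    intro x
    have hx : ∀ ω, edist (hφ.toL1 (Z ω)) x =
        ∫⁻ p, edist (φ p.2 ((Z ω).1 p.1)) (x p) ∂coordMeasure := fun ω => by
      rw [L1.edist_def]
      exact lintegral_congr_ae ((hφ.coeFn_toL1 (Z ω)).mono fun p hp => by simp only [hp])
    simp_rw [hx]
    have hjoint : Measurable fun q : Ω × (I × ℕ) => φ q.2.2 ((Z q.1).1 q.2.1) := by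
      have h2 : Measurable fun q : (Ω × I) × ℕ => φ q.2 ((Z q.1.1).1 q.1.2) :=
        measurable_from_prod_countable_left fun j =>
          measurable_uncurry_of_rightCont (fun ω => hφ.rightCont j (Z ω))
            fun t => (hφ.continuous j).measurable.comp (hall t)
      exact h2.comp ((measurable_fst.prodMk (measurable_fst.comp measurable_snd)).prodMk
        (measurable_snd.comp measurable_snd))
    exact (hjoint.edist ((Lp.stronglyMeasurable x).measurable.comp
      measurable_snd)).lintegral_prod_right'
  let _ : MeasurableSpace (Lp ℝ 1 coordMeasure) := borel _
  have : BorelSpace (Lp ℝ 1 coordMeasure) := ⟨rfl⟩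
  rw [measurable_comp_iff_of_isEmbedding hφ.isEmbedding_toL1]
  refine measurable_of_isOpen fun U hU => ?_
  obtain ⟨D, hDc, hD⟩ := TopologicalSpace.exists_countable_dense (Lp ℝ 1 coordMeasure)
  have hUeq : (fun ω => hφ.toL1 (Z ω)) ⁻¹' U = ⋃ x ∈ D, ⋃ n ∈ {n : ℕ |
      Metric.eball x ((n : ℝ≥0∞) + 1)⁻¹ ⊆ U},
      {ω | edist (hφ.toL1 (Z ω)) x < ((n : ℝ≥0∞) + 1)⁻¹} := by
    ext ω
    simp only [mem_preimage, mem_iUnion, mem_ofPred_eq, exists_prop]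
    refine ⟨fun hω => ?_, fun ⟨x, _, n, hn, hω⟩ => hn hω⟩
    obtain ⟨ε, hε, hεU⟩ := EMetric.isOpen_iff.1 hU _ hω
    obtain ⟨n, hn⟩ := ENNReal.exists_inv_nat_lt (ENNReal.half_pos hε.ne').ne'
    have hn' : ((n : ℝ≥0∞) + 1)⁻¹ < ε / 2 := lt_of_le_of_lt (by gcongr; exact le_self_add) hn
    obtain ⟨x, hx, hxω⟩ := EMetric.mem_closure_iff.1 (hD (hφ.toL1 (Z ω))) (((n : ℝ≥0∞) + 1)⁻¹)
      (by simp)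
    refine ⟨x, hx, n, fun y hy => hεU ?_, hxω⟩
    rw [Metric.mem_eball] at hy ⊢
    calc edist y _ ≤ edist y x + edist x (hφ.toL1 (Z ω)) := edist_triangle _ _ _
      _ < ε / 2 + ε / 2 := ENNReal.add_lt_add (hy.trans hn')
        ((edist_comm x _).trans_lt (hxω.trans hn'))
      _ = ε := ENNReal.add_halves ε
  rw [hUeq]
  exact MeasurableSet.biUnion hDc fun x _ => MeasurableSet.biUnion (to_countable _)
    fun n _ => measurableSet_lt (key x) measurable_const

end

/-! ### Upcrossings along a set of times -/

/-- `UpChain g A a b N x`: the function `g` has `N` successive upcrossings from below `a` to above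
`b` at times in `A` that are at least `x`. -/
inductive UpChain (g : I → ℝ) (A : Set I) (a b : ℝ) : ℕ → I → Prop
  | zero (x : I) : UpChain g A a b 0 x
  | succ {N : ℕ} {x s t : I} (hs : s ∈ A) (ht : t ∈ A) (hxs : x ≤ s) (hst : s < t)
      (hgs : g s < a) (hgt : b < g t) (h : UpChain g A a b N t) : UpChain g A a b (N + 1) x

namespace UpChain

variable {g : I → ℝ} {A : Set I} {a b : ℝ} {N : ℕ} {x y : I}

theorem of_le (h : UpChain g A a b N x) (hyx : y ≤ x) : UpChain g A a b N y := by
  cases h with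
  | zero => exact zero y
  | succ hs ht hxs hst hgs hgt h => exact succ hs ht (hyx.trans hxs) hst hgs hgt h

theorem mono (h : UpChain g A a b N x) {B : Set I} (hAB : A ⊆ B) : UpChain g B a b N x := by
  induction h with
  | zero x => exact zero x
  | succ hs ht hxs hst hgs hgt _ ih => exact succ (hAB hs) (hAB ht) hxs hst hgs hgt ih

theorem exists_of_iUnion {B : ℕ → Set I} (hB : Monotone B) (h : UpChain g (⋃ k, B k) a b N x) :
    ∃ k, UpChain g (B k) a b N x := by
  induction h with
  | zero x => exact ⟨0, zero x⟩
  | succ hs ht hxs hst hgs hgt _ ih =>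
    obtain ⟨k, hk⟩ := ih
    obtain ⟨i, hi⟩ := mem_iUnion.1 hs
    obtain ⟨j, hj⟩ := mem_iUnion.1 ht
    refine ⟨max k (max i j), succ (hB ?_ hi) (hB ?_ hj) hxs hst hgs hgt (hk.mono (hB ?_))⟩ <;> simp

/-- Chains of a pointwise limit come from chains of the approximations. -/
theorem eventually_of_tendsto {ι : Type v} {l : Filter ι} {u : ι → I → ℝ}
    (hu : ∀ t ∈ A, Tendsto (fun i => u i t) l (𝓝 (g t))) (h : UpChain g A a b N x) :
    ∀ᶠ i in l, UpChain (u i) A a b N x := by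
  induction h with
  | zero x => exact Eventually.of_forall fun i => zero x
  | succ hs ht hxs hst hgs hgt _ ih =>
    filter_upwards [ih, (hu _ hs).eventually (gt_mem_nhds hgs),
      (hu _ ht).eventually (lt_mem_nhds hgt)] with i h1 h2 h3
    exact succ hs ht hxs hst h2 h3 h1

/-- If `g` is the right limit of `f` along a dense set `A` of times, then chains of `g` yield
chains of `f` at times in `A`. -/
theorem of_rightLimit {f : I → ℝ} (hA : Dense A) (h1 : (1 : I) ∈ A) (hf1 : f 1 = g 1)
    (hf : ∀ t, t ≠ 1 → Tendsto f (𝓝[A ∩ Ioi t] t) (𝓝 (g t)))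
    (h : UpChain g univ a b N x) : UpChain f A a b N x := by
  -- The times of `g` are moved to the right into `A`. The chain of `f` must start strictly after
  -- `x`, so that the time before it can be moved too.
  have key : x ≠ 1 → ∃ y, x < y ∧ UpChain f A a b N y := by
    induction h with
    | zero x => exact fun hx => ⟨1, lt_of_le_of_ne unitInterval.le_one' hx, zero 1⟩
    | @succ N x s t hs ht hxs hst hgs hgt h ih =>
      intro hx
      have hs1 : s ≠ 1 := (hst.trans_le unitInterval.le_one').ne
      have hpick : ∀ {s z : I} {p : ℝ → Prop}, s ≠ 1 → s < z → (∀ᶠ r in 𝓝 (g s), p r) →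
          ∃ s' ∈ A, s < s' ∧ s' < z ∧ p (f s') := by
        intro s z p hs1 hsz hp
        have := neBot_nhdsWithin_inter_Ioi hA hs1
        have h2 : ∀ᶠ s' in 𝓝[A ∩ Ioi s] s, s' < z :=
          eventually_nhdsWithin_of_eventually_nhds (gt_mem_nhds hsz)
        obtain ⟨s', ⟨⟨h3, h4⟩, h5⟩, h6⟩ :=
          ((eventually_mem_nhdsWithin.and h2).and ((hf s hs1).eventually hp)).exists
        exact ⟨s', h3, h4, h5, h6⟩
      obtain ⟨s', hs'A, hss', hs't, hs'⟩ := hpick hs1 hst (gt_mem_nhds hgs)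
      refine ⟨s', hxs.trans_lt hss', ?_⟩
      -- The time `1` cannot be moved, but there `f` and `g` agree, and no further upcrossing can
      -- follow it.
      rcases eq_or_ne t 1 with rfl | ht1
      · cases h with
        | zero => exact succ hs'A h1 le_rfl hs't hs' (hf1 ▸ hgt) (zero 1)
        | succ _ _ h3 h4 =>
          exact absurd (h3.trans_lt h4) (not_lt.2 unitInterval.le_one')
      · obtain ⟨y, hty, hy⟩ := ih ht1
        obtain ⟨t', ht'A, htt', ht'y, ht'⟩ := hpick ht1 hty (lt_mem_nhds hgt)
        exact succ hs'A ht'A le_rfl (hs't.trans htt') hs' ht' (hy.of_le ht'y.le)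
  rcases eq_or_ne x 1 with rfl | hx
  · cases h with
    | zero => exact zero 1
    | succ _ _ h3 h4 => exact absurd (h3.trans_lt h4) (not_lt.2 unitInterval.le_one')
  · obtain ⟨y, hxy, hy⟩ := key hx
    exact hy.of_le hxy.le

theorem of_frequently_left {t : I} (ha : ∃ᶠ s in 𝓝[A ∩ Iio t] t, g s < a)
    (hb : ∃ᶠ s in 𝓝[A ∩ Iio t] t, b < g s) (N : ℕ) : ∀ x < t, UpChain g A a b N x := by
  induction N with
  | zero => exact fun x _ => zero x
  | succ N ih =>
    intro x hx
    have hpick : ∀ {z : I} {p : I → Prop}, z < t → (∃ᶠ s in 𝓝[A ∩ Iio t] t, p s) →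
        ∃ s ∈ A, z < s ∧ s < t ∧ p s := by
      intro z p hz hp
      have h2 : ∀ᶠ s in 𝓝[A ∩ Iio t] t, z < s :=
        eventually_nhdsWithin_of_eventually_nhds (lt_mem_nhds hz)
      obtain ⟨s, hs, ⟨h3, h4⟩, h5⟩ := (hp.and_eventually (eventually_mem_nhdsWithin.and h2)).exists
      exact ⟨s, h3, h5, h4, hs⟩
    obtain ⟨s, hsA, hxs, hst, hs⟩ := hpick hx ha
    obtain ⟨r, hrA, hsr, hrt, hr⟩ := hpick hst hb
    exact succ hsA hrA hxs.le hsr hs hr (ih r hrt)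

/-- Times accumulate at `t` from the right, so each new upcrossing is inserted before those already
found. -/
theorem of_frequently_right {t : I} (ha : ∃ᶠ s in 𝓝[A ∩ Ioi t] t, g s < a)
    (hb : ∃ᶠ s in 𝓝[A ∩ Ioi t] t, b < g s) (N : ℕ) : UpChain g A a b N t := by
  suffices h : ∃ x, t < x ∧ UpChain g A a b N x by
    obtain ⟨x, hx, h⟩ := h
    exact h.of_le hx.le
  have hpick : ∀ {z : I} {p : I → Prop}, t < z → (∃ᶠ s in 𝓝[A ∩ Ioi t] t, p s) →
      ∃ s ∈ A, t < s ∧ s < z ∧ p s := by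
    intro z p hz hp
    have h2 : ∀ᶠ s in 𝓝[A ∩ Ioi t] t, s < z :=
      eventually_nhdsWithin_of_eventually_nhds (gt_mem_nhds hz)
    obtain ⟨s, hs, ⟨h3, h4⟩, h5⟩ := (hp.and_eventually (eventually_mem_nhdsWithin.and h2)).exists
    exact ⟨s, h3, h4, h5, hs⟩
  induction N with
  | zero =>
    obtain ⟨s, -, ⟨-, hs⟩⟩ := (ha.and_eventually eventually_mem_nhdsWithin).exists
    exact ⟨s, hs, zero s⟩
  | succ N ih =>
    obtain ⟨x, hx, h⟩ := ih
    obtain ⟨r, hrA, htr, hrx, hr⟩ := hpick hx hb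
    obtain ⟨s, hsA, hts, hsr, hs⟩ := hpick htr ha
    exact ⟨s, hts, succ hsA hrA le_rfl hsr hs hr (h.of_le hrx.le)⟩

/-- One-sided limits exist if chains have bounded length. -/
theorem exists_tendsto_left {t : I} (hb : ∀ x, g x ∈ Icc (0 : ℝ) 1)
    (h : ∀ a b : ℚ, a < b → ∃ N, ¬ UpChain g A a b N 0) :
    ∃ c, Tendsto g (𝓝[A ∩ Iio t] t) (𝓝 c) := by
  refine tendsto_of_no_upcrossings (s := range ((↑) : ℚ → ℝ)) Rat.denseRange_cast ?_
    (isBoundedUnder_of ⟨1, fun x => (hb x).2⟩) (isBoundedUnder_of ⟨0, fun x => (hb x).1⟩)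
  rintro _ ⟨a, rfl⟩ _ ⟨b, rfl⟩ hab ⟨h1, h2⟩
  obtain ⟨N, hN⟩ := h a b (by exact_mod_cast hab)
  rcases eq_or_ne t 0 with rfl | ht
  · refine h1 ?_
    filter_upwards [self_mem_nhdsWithin] with s hs
    exact absurd hs.2 (not_lt.2 unitInterval.nonneg')
  · exact hN (of_frequently_left h1 h2 N 0 (lt_of_le_of_ne unitInterval.nonneg' ht.symm))

theorem exists_tendsto_right {t : I} (hb : ∀ x, g x ∈ Icc (0 : ℝ) 1)
    (h : ∀ a b : ℚ, a < b → ∃ N, ¬ UpChain g A a b N 0) :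
    ∃ c, Tendsto g (𝓝[A ∩ Ioi t] t) (𝓝 c) := by
  refine tendsto_of_no_upcrossings (s := range ((↑) : ℚ → ℝ)) Rat.denseRange_cast ?_
    (isBoundedUnder_of ⟨1, fun x => (hb x).2⟩) (isBoundedUnder_of ⟨0, fun x => (hb x).1⟩)
  rintro _ ⟨a, rfl⟩ _ ⟨b, rfl⟩ hab ⟨h1, h2⟩
  obtain ⟨N, hN⟩ := h a b (by exact_mod_cast hab)
  exact hN ((of_frequently_right h1 h2 N).of_le unitInterval.nonneg')

end UpChain

/-- A real function differs from its right limit along `A` at countably many points of `A` only. -/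
theorem countable_ne_rightLimit {A : Set I} {f g : I → ℝ}
    (hfg : ∀ t, t ≠ 1 → Tendsto f (𝓝[A ∩ Ioi t] t) (𝓝 (g t))) (h1 : f 1 = g 1) :
    {t ∈ A | f t ≠ g t}.Countable := by
  -- A strict gap between `f t` and the right limit persists on `A` up to some dyadic `q > t`. For
  -- fixed `q`, a real function has only countably many such points.
  have hsub : {t ∈ A | f t ≠ g t} ⊆
      (⋃ q ∈ dyadicPts, {x ∈ A ∩ Iic q | ∃ z, f x < z ∧ ∀ y ∈ A ∩ Iic q, x < y → z ≤ f y}) ∪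
      ⋃ q ∈ dyadicPts, {x ∈ A ∩ Iic q | ∃ z, z < f x ∧ ∀ y ∈ A ∩ Iic q, x < y → f y ≤ z} := by
    rintro t ⟨htA, htne⟩
    have ht : t ≠ 1 := fun h => htne (h ▸ h1)
    have hq : ∀ {p : I → Prop}, (∀ᶠ s in 𝓝[A ∩ Ioi t] t, p s) →
        ∃ q ∈ dyadicPts, t < q ∧ ∀ y ∈ A ∩ Iic q, t < y → p y := by
      intro p hp
      rw [inter_comm, nhdsWithin_inter', eventually_inf_principal] at hp
      obtain ⟨u, hu, hus⟩ := (mem_nhdsGT_iff_exists_Ioo_subset'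
        (lt_of_le_of_ne unitInterval.le_one' ht)).1 hp
      obtain ⟨k, hk⟩ := ((tendsto_gridUp_gt ht).eventually (Ioo_mem_nhdsGT hu)).exists
      exact ⟨gridUp k t, gridUp_mem k t, hk.1, fun y hy hty => hus ⟨hty, hy.2.trans_lt hk.2⟩ hy.1⟩
    rcases lt_or_gt_of_ne htne with hlt | hlt
    · left
      obtain ⟨z, hz1, hz2⟩ := exists_between hlt
      obtain ⟨q, hqD, htq, hq⟩ := hq ((hfg t ht).eventually (lt_mem_nhds hz2))
      exact mem_biUnion hqD ⟨⟨htA, htq.le⟩, z, hz1, fun y hy hty => (hq y hy hty).le⟩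
    · right
      obtain ⟨z, hz1, hz2⟩ := exists_between hlt
      obtain ⟨q, hqD, htq, hq⟩ := hq ((hfg t ht).eventually (gt_mem_nhds hz1))
      exact mem_biUnion hqD ⟨⟨htA, htq.le⟩, z, hz2, fun y hy hty => (hq y hy hty).le⟩
  exact ((countable_dyadicPts.biUnion fun q _ => countable_image_lt_image_Ioi_within _ _).union
    (countable_dyadicPts.biUnion fun q _ => countable_image_gt_image_Ioi_within _ _)).mono hsub

/-- **Regularization.** A function with values in a compact set along a dense set `A ∋ 1` of times,
whose coordinates have finitely many upcrossings, has a càdlàg regularization. -/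
theorem CoordEmb.exists_cadlag {E : Type u} [TopologicalSpace E] {φ : ℕ → E → ℝ}
    (hφ : CoordEmb φ) {K : Set E} (hK : IsCompact K) {A : Set I} (hA : Dense A) (h1 : (1 : I) ∈ A)
    {f : I → E} (hf : ∀ t ∈ A, f t ∈ K)
    (hchain : ∀ j, ∀ a b : ℚ, a < b → ∃ N, ¬ UpChain (fun t => φ j (f t)) A a b N 0) :
    ∃ g : I → E, IsCadlag g ∧ (∀ t, g t ∈ K) ∧ g 1 = f 1 ∧
      (∀ t, t ≠ 1 → Tendsto f (𝓝[A ∩ Ioi t] t) (𝓝 (g t))) ∧ {t ∈ A | f t ≠ g t}.Countable := by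
  have hmet := hφ.metrizableSpace
  have hright : ∀ t, t ≠ 1 → ∃ x ∈ K, Tendsto f (𝓝[A ∩ Ioi t] t) (𝓝 x) := by
    intro t ht
    have := neBot_nhdsWithin_inter_Ioi hA ht
    choose c hc using fun j => UpChain.exists_tendsto_right (t := t)
      (fun x => hφ.mem_Icc j (f x)) (hchain j)
    obtain ⟨x, hx, hfx, -⟩ := hφ.exists_tendsto hK
      (eventually_nhdsWithin_of_forall fun s hs => hf s hs.1) hc
    exact ⟨x, hx, hfx⟩
  have hleft : ∀ t, t ≠ 0 → ∃ x, Tendsto f (𝓝[A ∩ Iio t] t) (𝓝 x) := by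
    intro t ht
    have := neBot_nhdsWithin_inter_Iio hA ht
    choose c hc using fun j => UpChain.exists_tendsto_left (t := t)
      (fun x => hφ.mem_Icc j (f x)) (hchain j)
    obtain ⟨x, hx, hfx, -⟩ := hφ.exists_tendsto hK
      (eventually_nhdsWithin_of_forall fun s hs => hf s hs.1) hc
    exact ⟨x, hfx⟩
  have hex : ∀ t, ∃ x ∈ K, (t = 1 → x = f 1) ∧ (t ≠ 1 → Tendsto f (𝓝[A ∩ Ioi t] t) (𝓝 x)) := by
    intro t
    by_cases ht : t = 1
    · exact ⟨f 1, hf 1 h1, fun _ => rfl, fun h => absurd ht h⟩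
    · obtain ⟨x, hx, hfx⟩ := hright t ht
      exact ⟨x, hx, fun h => absurd h ht, fun _ => hfx⟩
  choose g hgK hg1 hg using hex
  refine ⟨g, ⟨fun t => ?_, fun t => ?_⟩, hgK, hg1 1 rfl, hg, ?_⟩
  · rcases eq_or_ne t 1 with rfl | ht
    · refine continuousWithinAt_singleton.mono fun s hs => ?_
      exact le_antisymm unitInterval.le_one' hs
    · intro V hV
      -- Values of `g` shortly after `t` are limits of values of `f` in `W`; a closed neighbourhood
      -- keeps them. Left limits below use the same device.
      obtain ⟨W, ⟨hW, hWc⟩, hWV⟩ := (closed_nhds_basis (g t)).mem_iff.1 hV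
      have h2 := (hg t ht).eventually hW
      rw [inter_comm, nhdsWithin_inter', eventually_inf_principal] at h2
      obtain ⟨u, hu, hus⟩ := (mem_nhdsGT_iff_exists_Ioo_subset'
        (lt_of_le_of_ne unitInterval.le_one' ht)).1 h2
      refine mem_map.2 (mem_of_superset (Ico_mem_nhdsGE hu) fun s hs => hWV ?_)
      rcases eq_or_lt_of_le hs.1 with rfl | hts
      · exact mem_of_mem_nhds hW
      · have hs1 : s ≠ 1 := (hs.2.trans_le unitInterval.le_one').ne
        have := neBot_nhdsWithin_inter_Ioi hA hs1
        refine hWc.mem_of_tendsto (hg s hs1) ?_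
        filter_upwards [self_mem_nhdsWithin,
          mem_nhdsWithin_of_mem_nhds (Iio_mem_nhds hs.2)] with r hr hru
        exact hus ⟨hts.trans hr.2, hru⟩ hr.1
  · rcases eq_or_ne t 0 with rfl | ht
    · refine ⟨g 0, ?_⟩
      have : Iio (0 : I) = ∅ := eq_empty_of_forall_notMem fun s hs =>
        not_lt.2 unitInterval.nonneg' hs
      rw [this, nhdsWithin_empty]
      exact tendsto_bot
    · obtain ⟨x, hx⟩ := hleft t ht
      refine ⟨x, fun V hV => ?_⟩
      obtain ⟨W, ⟨hW, hWc⟩, hWV⟩ := (closed_nhds_basis x).mem_iff.1 hV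
      have h2 := hx.eventually hW
      rw [inter_comm, nhdsWithin_inter', eventually_inf_principal] at h2
      obtain ⟨u, hu, hus⟩ := (mem_nhdsLT_iff_exists_Ioo_subset'
        (lt_of_le_of_ne unitInterval.nonneg' ht.symm)).1 h2
      refine mem_map.2 (mem_of_superset (Ioo_mem_nhdsLT hu) fun s hs => hWV ?_)
      have hs1 : s ≠ 1 := (hs.2.trans_le unitInterval.le_one').ne
      have := neBot_nhdsWithin_inter_Ioi hA hs1
      refine hWc.mem_of_tendsto (hg s hs1) ?_
      filter_upwards [self_mem_nhdsWithin,
        mem_nhdsWithin_of_mem_nhds (Iio_mem_nhds hs.2)] with r hr hrt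
      exact hus ⟨hs.1.trans hr.2, hrt⟩ hr.1
  · have hsub : {t ∈ A | f t ≠ g t} ⊆ ⋃ j, {t ∈ A | φ j (f t) ≠ φ j (g t)} := by
      rintro t ⟨htA, ht⟩
      by_contra hcon
      simp only [mem_iUnion, mem_ofPred_eq, not_exists, not_and, not_not] at hcon
      exact ht (hφ.eq_of_forall fun j => hcon j htA)
    refine (countable_iUnion fun j => ?_).mono hsub
    refine countable_ne_rightLimit (fun t ht => ?_) (by rw [hg1 1 rfl])
    exact ((hφ.continuous j).tendsto _).comp (hg t ht)

/-! ### Compact sets of paths -/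

/-- Compactness in path space: values in a compact set, bounded numbers of upcrossings, and
coordinates in a compact subset of `L¹`. -/
theorem CoordEmb.isCompact_setOf_path {E : Type u} [TopologicalSpace E] {φ : ℕ → E → ℝ}
    (hφ : CoordEmb φ) {K L : Set E} (hK : IsCompact K) (hL : IsClosed L)
    {C : Set (Lp ℝ 1 coordMeasure)} (hC : IsCompact C) (N : ℕ → ℚ → ℚ → ℕ) :
    IsCompact {f : CadlagPath E | (∀ t, f.1 t ∈ K) ∧ f.1 1 ∈ L ∧
      (∀ j, ∀ a b : ℚ, a < b → ¬ UpChain (fun t => φ j (f.1 t)) univ a b (N j a b) 0) ∧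
      hφ.toL1 f ∈ C} := by
  have hmet := hφ.metrizableSpace
  rw [hφ.isEmbedding_toL1.isCompact_iff]
  refine hC.of_isClosed_subset (IsSeqClosed.isClosed fun y x hy hyx => ?_)
    (image_subset_iff.2 fun f hf => hf.2.2.2)
  choose f hf hfy using hy
  have hfx : Tendsto (fun n => hφ.toL1 (f n)) atTop (𝓝 x) := by simpa only [hfy] using hyx
  have hxC : x ∈ C := hC.isClosed.mem_of_tendsto hfx (Eventually.of_forall fun n => (hf n).2.2.2)
  obtain ⟨ns, -, hns⟩ := hφ.exists_seq_of_tendsto hfx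
  -- A set of full `λ`-measure: it is dense, and the atom puts `1` into it. The limit path is first
  -- defined on `A` and then regularized.
  let A : Set I := {t | ∀ j, Tendsto (fun i => φ j ((f (ns i)).1 t)) atTop (𝓝 (x (t, j)))}
  have hA : Dense A := dense_of_ae_mzMeasure hns
  have h1 : (1 : I) ∈ A := mem_one_of_ae_mzMeasure hns
  have hlim : ∀ t, ∃ e : E, t ∈ A → e ∈ K ∧ Tendsto (fun i => (f (ns i)).1 t) atTop (𝓝 e) ∧
      ∀ j, φ j e = x (t, j) := by
    intro t
    by_cases ht : t ∈ A
    · obtain ⟨e, h⟩ := hφ.exists_tendsto hK (Eventually.of_forall fun i => (hf (ns i)).1 t) ht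
      exact ⟨e, fun _ => h⟩
    · exact ⟨(f 0).1 t, fun h => absurd h ht⟩
  choose F hF using hlim
  -- Upcrossings are given by strict inequalities at finitely many times, so a chain of the limit
  -- would be a chain of late approximations.
  have hchain : ∀ j, ∀ a b : ℚ, a < b → ¬ UpChain (fun t => φ j (F t)) A a b (N j a b) 0 := by
    intro j a b hab h
    obtain ⟨i, hi⟩ := (h.eventually_of_tendsto (l := atTop)
      (u := fun i t => φ j ((f (ns i)).1 t))
      fun t ht => ((hφ.continuous j).tendsto _).comp (hF t ht).2.1).exists
    exact (hf (ns i)).2.2.1 j a b hab (hi.mono (subset_univ _))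
  obtain ⟨g, hgc, hgK, hg1, hgr, hgcount⟩ := hφ.exists_cadlag hK hA h1 (fun t ht => (hF t ht).1)
    fun j a b hab => ⟨_, hchain j a b hab⟩
  -- Regularization changes `F` at countably many points of `A`, and not at `1`, hence only on a
  -- `λ`-null set.
  have hgx : hφ.toL1 ⟨g, hgc⟩ = x := by
    refine Lp.ext ?_
    refine (hφ.coeFn_toL1 _).trans ?_
    refine ae_coordMeasure_iff.2 ?_
    have h0 : ∀ᵐ t ∂mzMeasure, t ∉ {t ∈ A | F t ≠ g t} :=
      measure_eq_zero_iff_ae_notMem.1 (mzMeasure_eq_zero_of_countable hgcount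
        fun h => h.2 hg1.symm)
    filter_upwards [hns, h0] with t ht ht0 j
    have hFg : F t = g t := by
      by_contra hne
      exact ht0 ⟨ht, hne⟩
    rw [← hFg, (hF t ht).2.2 j]
  refine ⟨⟨g, hgc⟩, ⟨hgK, ?_, fun j a b hab h => ?_, hgx.symm ▸ hxC⟩, hgx⟩
  · have : F 1 ∈ L := hL.mem_of_tendsto (hF 1 h1).2.1 (Eventually.of_forall fun i => (hf _).2.1)
    rwa [← hg1] at this
  · refine hchain j a b hab (h.of_rightLimit hA h1 ?_ fun t ht => ?_)
    · exact congrArg (φ j) hg1.symm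
    · exact ((hφ.continuous j).tendsto _).comp (hgr t ht)

/-- A random variable is tight if it belongs to suitable compact sets with probability close
to one. -/
def TightRV {Ω : Type v} {mΩ : MeasurableSpace Ω} (P : Measure Ω) {E : Type u}
    [TopologicalSpace E] (Y : Ω → E) : Prop :=
  ∀ ε : ℝ≥0∞, 0 < ε → ∃ K : Set E, IsCompact K ∧ P {ω | Y ω ∉ K} ≤ ε

theorem tightRV_of_polish {Ω : Type v} {mΩ : MeasurableSpace Ω} {P : Measure Ω}
    [IsFiniteMeasure P] {E : Type u} [TopologicalSpace E] [PolishSpace E] [MeasurableSpace E]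
    [BorelSpace E]
    {Y : Ω → E} (hY : Measurable Y) : TightRV P Y := by
  intro ε hε
  obtain ⟨K, hK, h⟩ := isTightMeasureSet_iff_exists_isCompact_measure_compl_le.1
    (isTightMeasureSet_singleton (μ := P.map Y)) ε hε
  refine ⟨K, hK, (h _ rfl).trans' ?_⟩
  rw [Measure.map_apply hY hK.isClosed.measurableSet.compl]
  rfl

/-! ### Martingale inequalities along dyadic times -/

section

variable {Ω : Type v} {mΩ : MeasurableSpace Ω} {P : Measure Ω}
  {ℱ : Filtration I mΩ}

/-- The filtration observed along the dyadic grid of level `k`. -/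
noncomputable def gridFiltration (ℱ : Filtration I mΩ) (k : ℕ) : Filtration ℕ mΩ where
  seq i := ℱ (gridPt k i)
  mono' _ _ h := ℱ.mono (gridPt_mono k h)
  le' _ := ℱ.le _

theorem martingale_grid {M : I → Ω → ℝ} (hM : Martingale M ℱ P) (k : ℕ) :
    Martingale (fun i => M (gridPt k i)) (gridFiltration ℱ k) P :=
  ⟨fun _ => hM.1 _, fun _ _ hij => hM.2 _ _ (gridPt_mono k hij)⟩

/-- Each link of the chain raises the upcrossing count. The hypothesis `hi` keeps the indices
increasing although many indices represent the time `1`: after an upcrossing ending at `t`, a later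
value below `a` cannot occur at `t` itself, so its index is strictly larger. -/
theorem UpChain.le_upcrossingsBefore {M : I → Ω → ℝ} {a b : ℝ} (hab : a < b) {k N : ℕ} {ω : Ω}
    {x : I} (h : UpChain (fun t => M t ω) (gridLevel k) a b N x) (i : ℕ)
    (hi : ∀ s ∈ gridLevel k, x ≤ s → M s ω < a → ∃ l ≥ i, gridPt k l = s) :
    ∃ m, upcrossingsBefore a b (fun i => M (gridPt k i)) i ω + N ≤
      upcrossingsBefore a b (fun i => M (gridPt k i)) m ω := by
  induction h generalizing i with
  | zero x => exact ⟨i, le_rfl⟩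
  | @succ N x s t hs ht hxs hst hgs hgt h ih =>
    obtain ⟨l, hil, rfl⟩ := hi s hs hxs hgs
    obtain ⟨r, rfl⟩ := ht
    have hlr : l ≤ r := (gridPt_mono k).reflect_lt hst |>.le
    have hlt := upcrossingsBefore_lt_of_exists_upcrossing
      (f := fun i => M (gridPt k i)) hab hil hgs hlr hgt
    obtain ⟨m, hm⟩ := ih (r + 1) fun s hs hts hsa => by
      obtain ⟨q, rfl⟩ := hs
      refine ⟨q, (gridPt_mono k).reflect_lt (lt_of_le_of_ne hts fun heq => ?_), rfl⟩
      rw [heq] at hgt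
      exact (hsa.trans hab).not_gt hgt
    exact ⟨m, by omega⟩

/-- Doob's upcrossing inequality along dyadic times. -/
theorem measure_upChain_le [IsProbabilityMeasure P] {M : I → Ω → ℝ} (hM : Martingale M ℱ P)
    (hM1 : ∀ t ω, M t ω ∈ Icc (0 : ℝ) 1) {a b : ℝ} (hab : a < b) (N : ℕ) :
    ENNReal.ofReal (b - a) * (N * P {ω | UpChain (fun t => M t ω) dyadicPts a b N 0}) ≤
      ENNReal.ofReal (1 + |a|) := by
  have hU : {ω | UpChain (fun t => M t ω) dyadicPts a b N 0} =
      ⋃ k, {ω | UpChain (fun t => M t ω) (gridLevel k) a b N 0} := by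
    ext ω
    simp only [mem_iUnion, mem_ofPred_eq]
    exact ⟨fun h => h.exists_of_iUnion gridLevel_mono,
      fun ⟨k, h⟩ => h.mono (subset_iUnion gridLevel k)⟩
  have hmono : Monotone fun k => {ω | UpChain (fun t => M t ω) (gridLevel k) a b N 0} :=
    fun k l hkl ω h => h.mono (gridLevel_mono hkl)
  rw [hU, hmono.measure_iUnion, ENNReal.mul_iSup, ENNReal.mul_iSup]
  refine iSup_le fun k => ?_
  have hMk := martingale_grid hM k
  have hsub : {ω | UpChain (fun t => M t ω) (gridLevel k) a b N 0} ⊆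
      {ω | (N : ℝ≥0∞) ≤ upcrossings a b (fun i => M (gridPt k i)) ω} := by
    intro ω hω
    obtain ⟨m, hm⟩ := UpChain.le_upcrossingsBefore hab hω 0
      fun s hs _ _ => let ⟨l, hl⟩ := hs; ⟨l, Nat.zero_le l, hl⟩
    refine le_iSup_of_le
      (f := fun n => (upcrossingsBefore a b (fun i => M (gridPt k i)) n ω : ℝ≥0∞)) m ?_
    exact_mod_cast (Nat.le_add_left N _).trans hm
  calc ENNReal.ofReal (b - a) * (N * P {ω | UpChain (fun t => M t ω) (gridLevel k) a b N 0})
      ≤ ENNReal.ofReal (b - a) * ∫⁻ ω, upcrossings a b (fun i => M (gridPt k i)) ω ∂P := by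
        gcongr
        -- Markov's inequality for the number of upcrossings.
        refine le_trans ?_ (mul_meas_ge_le_lintegral (hMk.1.measurable_upcrossings hab) N)
        gcongr
    _ ≤ ⨆ n, ∫⁻ ω, ENNReal.ofReal ((M (gridPt k n) ω - a)⁺) ∂P :=
        hMk.submartingale.mul_lintegral_upcrossings_le_lintegral_pos_part a b
    _ ≤ ENNReal.ofReal (1 + |a|) := by
        refine iSup_le fun n => ?_
        calc ∫⁻ ω, ENNReal.ofReal ((M (gridPt k n) ω - a)⁺) ∂P
            ≤ ∫⁻ _, ENNReal.ofReal (1 + |a|) ∂P := by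
              refine lintegral_mono fun ω => ENNReal.ofReal_le_ofReal ?_
              have h1 := (hM1 (gridPt k n) ω).2
              have h2 := neg_abs_le a
              exact sup_le (by linarith) (by positivity)
          _ = ENNReal.ofReal (1 + |a|) := by simp

/-- Doob's maximal inequality along dyadic times. -/
theorem measure_exists_dyadic_ge_le [IsProbabilityMeasure P] {M : I → Ω → ℝ} (hM : Martingale M ℱ P)
    (hM0 : ∀ t ω, 0 ≤ M t ω) (ε : NNReal) :
    ε * P {ω | ∃ t ∈ dyadicPts, ε ≤ M t ω} ≤ ENNReal.ofReal (∫ ω, M 1 ω ∂P) := by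
  have hV : {ω | ∃ t ∈ dyadicPts, ε ≤ M t ω} =
      ⋃ k, {ω | ∃ t ∈ gridLevel k, ε ≤ M t ω} := by
    ext ω
    simp only [dyadicPts, mem_iUnion, mem_ofPred_eq]
    exact ⟨fun ⟨t, ⟨k, hk⟩, h⟩ => ⟨k, t, hk, h⟩, fun ⟨k, t, hk, h⟩ => ⟨t, ⟨k, hk⟩, h⟩⟩
  have hmono : Monotone fun k => {ω | ∃ t ∈ gridLevel k, ε ≤ M t ω} :=
    fun k l hkl ω ⟨t, ht, h⟩ => ⟨t, gridLevel_mono hkl ht, h⟩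
  rw [hV, hmono.measure_iUnion, ENNReal.mul_iSup]
  refine iSup_le fun k => ?_
  have hW : {ω | ∃ t ∈ gridLevel k, ε ≤ M t ω} =
      ⋃ n, {ω | (ε : ℝ) ≤ (Finset.range (n + 1)).sup' Finset.nonempty_range_add_one
        fun i => M (gridPt k i) ω} := by
    ext ω
    simp only [gridLevel, mem_iUnion, mem_ofPred_eq, Finset.le_sup'_iff, Finset.mem_range]
    constructor
    · rintro ⟨t, ⟨i, rfl⟩, h⟩
      exact ⟨i, i, Nat.lt_succ_self i, h⟩
    · rintro ⟨n, i, -, h⟩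
      exact ⟨_, ⟨i, rfl⟩, h⟩
  have hmono' : Monotone fun n => {ω | (ε : ℝ) ≤ (Finset.range (n + 1)).sup'
      Finset.nonempty_range_add_one fun i => M (gridPt k i) ω} := by
    intro n m hnm ω h
    refine le_trans (show (ε : ℝ) ≤ _ from h) (Finset.sup'_mono _ ?_ _)
    exact Finset.range_mono (by omega)
  rw [hW, hmono'.measure_iUnion, ENNReal.mul_iSup]
  refine iSup_le fun n => ?_
  have hMk := martingale_grid hM k
  refine (maximal_ineq hMk.submartingale (fun i ω => hM0 _ ω) n).trans
    (ENNReal.ofReal_le_ofReal ?_)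
  have h1 : ∫ ω, M (gridPt k n) ω ∂P = ∫ ω, M 1 ω ∂P := by
    rw [← integral_condExp (ℱ.le (gridPt k n)) (f := M 1)]
    exact integral_congr_ae (hM.2 _ _ unitInterval.le_one').symm
  rw [← h1]
  exact setIntegral_le_integral (hM.integrable _) (ae_of_all _ fun ω => hM0 _ ω)

end

/-! ### Regular conditional laws -/

section CondLaw

/-- `κ` is a regular conditional law of `Y` given `m`. -/
structure IsCondLaw {Ω : Type v} {mΩ : MeasurableSpace Ω} (P : Measure Ω) (m : MeasurableSpace Ω)
    {E : Type u} [MeasurableSpace E] (Y : Ω → E) (κ : Ω → ProbabilityMeasure E) : Prop where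
  measurable : Measurable[m] κ
  condExp : ∀ B, MeasurableSet B → (fun ω => (κ ω : Measure E).real B) =ᵐ[P]
    P[(Y ⁻¹' B).indicator (fun _ => (1 : ℝ)) | m]

variable {Ω : Type v} {m mΩ : MeasurableSpace Ω} {P : Measure Ω} [IsProbabilityMeasure P]
  {E : Type u} [MeasurableSpace E]

theorem measurable_integral_probabilityMeasure {G : E → ℝ} (hG : Measurable G)
    {κ : Ω → ProbabilityMeasure E} (hκ : Measurable[m] κ) :
    Measurable[m] fun ω => ∫ x, G x ∂(κ ω : Measure E) := by
  have h : Measurable[m] fun ω => (κ ω : Measure E) := measurable_subtype_coe.comp hκ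
  let η : @ProbabilityTheory.Kernel Ω E m _ := ⟨fun ω => (κ ω : Measure E), h⟩
  have : ProbabilityTheory.IsMarkovKernel η := ⟨fun ω => (κ ω).2⟩
  exact (hG.stronglyMeasurable.integral_kernel (κ := η)).measurable

theorem abs_integral_probabilityMeasure_le {G : E → ℝ} {C : ℝ} (hC : ∀ x, |G x| ≤ C)
    (μ : ProbabilityMeasure E) : |∫ x, G x ∂(μ : Measure E)| ≤ C := by
  have := norm_integral_le_of_norm_le_const (μ := (μ : Measure E)) (f := G)
    (ae_of_all _ hC)
  simpa using this

theorem integral_bind_probabilityMeasure {Q : Measure Ω} [IsFiniteMeasure Q]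
    {κ : Ω → ProbabilityMeasure E} (hκ : Measurable κ) {G : E → ℝ} (hG : Measurable G)
    {C : ℝ} (hC : ∀ x, |G x| ≤ C) :
    ∫ x, G x ∂(Q.bind fun ω => (κ ω : Measure E)) = ∫ ω, ∫ x, G x ∂(κ ω : Measure E) ∂Q := by
  let η : ProbabilityTheory.Kernel Ω E :=
    ⟨fun ω => (κ ω : Measure E), measurable_subtype_coe.comp hκ⟩
  have : ProbabilityTheory.IsMarkovKernel η := ⟨fun ω => (κ ω).2⟩
  have h := ProbabilityTheory.Kernel.integral_comp (η := η)
    (κ := ProbabilityTheory.Kernel.const Unit Q) (a := ()) (f := G)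
    (Integrable.of_bound hG.aestronglyMeasurable C (ae_of_all _ hC))
  rwa [ProbabilityTheory.Kernel.comp_apply] at h

/-- Integrating the defining identity over `A` gives it on events; as an equality of measures it
then applies to all bounded functions at once. -/
theorem IsCondLaw.bind_eq_map {Y : Ω → E} {κ : Ω → ProbabilityMeasure E}
    (h : IsCondLaw P m Y κ) (hm : m ≤ mΩ) (hY : Measurable Y) {A : Set Ω}
    (hA : MeasurableSet[m] A) :
    (P.restrict A).bind (fun ω => (κ ω : Measure E)) = (P.restrict A).map Y := by
  ext B hB
  have hκ : Measurable fun ω => (κ ω : Measure E) :=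
    measurable_subtype_coe.comp (h.measurable.mono hm le_rfl)
  rw [Measure.bind_apply hB hκ.aemeasurable, Measure.map_apply hY hB]
  have hint : Integrable ((Y ⁻¹' B).indicator fun _ => (1 : ℝ)) P :=
    (integrable_const _).indicator (hY hB)
  have h1 : ∫ ω in A, (κ ω : Measure E).real B ∂P = (P.restrict A).real (Y ⁻¹' B) := by
    rw [setIntegral_congr_ae (g := P[(Y ⁻¹' B).indicator (fun _ => (1 : ℝ)) | m]) (hm _ hA)
      ((h.condExp B hB).mono fun _ h _ => h), setIntegral_condExp hm hint hA]
    exact integral_indicator_one (hY hB)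
  have h2 : ∫ ω in A, (κ ω : Measure E).real B ∂P =
      (∫⁻ ω in A, (κ ω : Measure E) B ∂P).toReal := by
    exact integral_toReal ((Measure.measurable_coe hB).comp hκ).aemeasurable
      (ae_of_all _ fun _ => measure_lt_top _ _)
  rw [h2] at h1
  refine (ENNReal.toReal_eq_toReal_iff' ?_ (measure_ne_top _ _)).1 h1
  have hle : ∫⁻ ω in A, (κ ω : Measure E) B ∂P ≤ ∫⁻ _ in A, 1 ∂P :=
    lintegral_mono fun ω => prob_le_one
  exact (hle.trans_lt (by simp)).ne

/-- Conditional expectations of bounded functions are integrals against the conditional law. -/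
theorem IsCondLaw.integral_ae_eq {Y : Ω → E} {κ : Ω → ProbabilityMeasure E}
    (h : IsCondLaw P m Y κ) (hm : m ≤ mΩ) (hY : Measurable Y) {G : E → ℝ} (hG : Measurable G)
    {C : ℝ} (hC : ∀ x, |G x| ≤ C) :
    (fun ω => ∫ x, G x ∂(κ ω : Measure E)) =ᵐ[P] P[fun ω => G (Y ω) | m] := by
  have hκ := measurable_integral_probabilityMeasure hG h.measurable
  have hi : Integrable (fun ω => ∫ x, G x ∂(κ ω : Measure E)) P :=
    Integrable.of_bound (hκ.mono hm le_rfl).aestronglyMeasurable C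
      (ae_of_all _ fun ω => abs_integral_probabilityMeasure_le hC _)
  refine ae_eq_condExp_of_forall_setIntegral_eq hm
    (Integrable.of_bound (hG.comp hY).aestronglyMeasurable C (ae_of_all _ fun ω => hC _))
    (fun _ _ _ => hi.integrableOn) (fun A hA _ => ?_) hκ.stronglyMeasurable.aestronglyMeasurable
  rw [← integral_bind_probabilityMeasure (h.measurable.mono hm le_rfl) hG hC,
    h.bind_eq_map hm hY hA, integral_map hY.aemeasurable hG.aestronglyMeasurable]

/-- A conditional law is determined by the integrals of bounded continuous functions. -/
theorem isCondLaw_of_forall_integral [TopologicalSpace E] [BorelSpace E] [HasOuterApproxClosed E]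
    {Y : Ω → E} {κ : Ω → ProbabilityMeasure E} (hm : m ≤ mΩ) (hY : Measurable Y)
    (hκ : Measurable[m] κ)
    (h : ∀ A, MeasurableSet[m] A → ∀ f : E →ᵇ ℝ,
      ∫ ω in A, ∫ x, f x ∂(κ ω : Measure E) ∂P = ∫ ω in A, f (Y ω) ∂P) :
    IsCondLaw P m Y κ := by
  refine ⟨hκ, fun B hB => ?_⟩
  have hκ' : Measurable κ := hκ.mono hm le_rfl
  have hκB : Measurable[m] fun ω => (κ ω : Measure E).real B :=
    (measurable_probabilityMeasure_iff.1 hκ B hB).ennreal_toReal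
  have hi : Integrable (fun ω => (κ ω : Measure E).real B) P :=
    Integrable.of_bound (hκB.mono hm le_rfl).aestronglyMeasurable 1
      (ae_of_all _ fun ω => by simp)
  refine ae_eq_condExp_of_forall_setIntegral_eq hm
    ((integrable_const _).indicator (hY hB))
    (fun _ _ _ => hi.integrableOn) (fun A hA _ => ?_) hκB.stronglyMeasurable.aestronglyMeasurable
  have hfin : IsFiniteMeasure ((P.restrict A).bind fun ω => (κ ω : Measure E)) := by
    refine ⟨?_⟩
    have hκ'' : Measurable fun ω => (κ ω : Measure E) := measurable_subtype_coe.comp hκ'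
    rw [Measure.bind_apply MeasurableSet.univ hκ''.aemeasurable]
    simp
  have key : (P.restrict A).bind (fun ω => (κ ω : Measure E)) = (P.restrict A).map Y := by
    refine ext_of_forall_integral_eq_of_IsFiniteMeasure fun f => ?_
    rw [integral_bind_probabilityMeasure hκ' f.continuous.measurable f.norm_coe_le_norm,
      integral_map hY.aemeasurable f.continuous.aestronglyMeasurable, h A hA f]
  have hG : Measurable (B.indicator fun _ => (1 : ℝ)) := measurable_const.indicator hB
  have hG1 : ∀ x, |B.indicator (fun _ => (1 : ℝ)) x| ≤ 1 := fun x => by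
    by_cases hx : x ∈ B <;> simp [hx]
  have h1 := integral_bind_probabilityMeasure (Q := P.restrict A) hκ' hG hG1
  rw [key, integral_map hY.aemeasurable hG.aestronglyMeasurable] at h1
  refine Eq.trans ?_ h1.symm
  refine integral_congr_ae (ae_of_all _ fun ω => ?_)
  exact (integral_indicator_one hB).symm

theorem isCondLaw_diracProba {Y : Ω → E} (hm : m ≤ mΩ) (hY : Measurable[m] Y) :
    IsCondLaw P m Y fun ω => diracProba (Y ω) := by
  have hB : ∀ B, MeasurableSet B → (fun ω => (diracProba (Y ω) : Measure E) B) =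
      (Y ⁻¹' B).indicator fun _ => (1 : ℝ≥0∞) := fun B hB => by
    ext ω
    simp only [diracProba, ProbabilityMeasure.coe_mk, Measure.dirac_apply' _ hB]
    rfl
  refine ⟨measurable_probabilityMeasure_iff.2 fun B h => ?_, fun B h => ?_⟩
  · rw [hB B h]
    exact measurable_const.indicator (hY h)
  · rw [condExp_of_stronglyMeasurable hm]
    · refine ae_of_all _ fun ω => ?_
      change ((diracProba (Y ω) : Measure E) B).toReal = _
      rw [congrFun (hB B h) ω]
      by_cases hω : ω ∈ Y ⁻¹' B <;> simp [hω]
    · exact (measurable_const.indicator (hY h)).stronglyMeasurable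
    · exact (integrable_const _).indicator ((hY.mono hm le_rfl) h)

/-- Regular conditional laws of tight random variables exist. -/
theorem exists_isCondLaw [TopologicalSpace E] [MetrizableSpace E] [SecondCountableTopology E]
    [BorelSpace E] {Y : Ω → E} (hm : m ≤ mΩ) (hY : Measurable Y) (hYt : TightRV P Y) :
    ∃ κ, IsCondLaw P m Y κ := by
  obtain ⟨φ, hφ⟩ := exists_coordEmb E
  let ι : E → ℕ → ℝ := fun x j => φ j x
  have hι : IsEmbedding ι := hφ.isEmbedding
  choose K hK hKP using fun k : ℕ => hYt (k + 1 : ℝ≥0∞)⁻¹ (by simp)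
  -- `E` is not assumed standard Borel, so the law is disintegrated in `ℕ → ℝ` and pulled back. `Y`
  -- lives on the `σ`-compact set `U`, whose image is Borel.
  let U : Set E := ⋃ k, K k
  have hU : ∀ᵐ ω ∂P, Y ω ∈ U := by
    have hle : ∀ k : ℕ, P {ω | Y ω ∉ U} ≤ (k : ℝ≥0∞)⁻¹ := fun k =>
      (measure_mono fun ω (hω : Y ω ∉ U) (hk : Y ω ∈ K k) => hω (mem_iUnion.2 ⟨k, hk⟩)).trans
        ((hKP k).trans (by simp))
    exact le_antisymm (ge_of_tendsto' ENNReal.tendsto_inv_nat_nhds_zero hle) bot_le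
  have hV : MeasurableSet (ι '' U) := by
    simp only [U, image_iUnion]
    exact .iUnion fun k => ((hK k).image hι.continuous).isClosed.measurableSet
  obtain ⟨ω₀⟩ : Nonempty Ω := nonempty_of_isProbabilityMeasure P
  classical
  -- A measurable left inverse of `ι` on `U`; the value elsewhere is arbitrary.
  let r : (ℕ → ℝ) → E := fun y => if h : y ∈ ι '' U then h.choose else Y ω₀
  have hr : ∀ x ∈ U, r (ι x) = x := fun x hx => by
    have h : ι x ∈ ι '' U := mem_image_of_mem _ hx
    simp only [r, dif_pos h]
    exact hι.injective h.choose_spec.2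
  have hrm : Measurable r := by
    intro B hB
    obtain ⟨B', hB', rfl⟩ : ∃ B', MeasurableSet B' ∧ ι ⁻¹' B' = B := by
      have : MeasurableSet[MeasurableSpace.comap ι inferInstance] B := by
        rwa [BorelSpace.measurable_eq (α := ℕ → ℝ), ← borel_comap, ← hι.eq_induced,
          ← BorelSpace.measurable_eq (α := E)]
      exact this
    have : r ⁻¹' (ι ⁻¹' B') = (ι '' U ∩ B') ∪ ((ι '' U)ᶜ ∩ {_y | ι (Y ω₀) ∈ B'}) := by
      ext y
      by_cases hy : y ∈ ι '' U
      · obtain ⟨x, hx, rfl⟩ := hy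
        simp [hr x hx, mem_image_of_mem ι hx]
      · simp only [r, mem_preimage, dif_neg hy]
        simp [hy]
    rw [this]
    exact (hV.inter hB').union (hV.compl.inter (.const _))
  have hιY : Measurable fun ω => ι (Y ω) := hι.continuous.measurable.comp hY
  -- Conditioning on the identity map into `(Ω, m)` is conditioning on `m`.
  let η := @ProbabilityTheory.condDistrib Ω Ω (ℕ → ℝ) _ _ _ mΩ m (fun ω => ι (Y ω)) id P _
  have hη : ∀ s, MeasurableSet s → (fun ω => (η ω).real s) =ᵐ[P]
      P[((fun ω => ι (Y ω)) ⁻¹' s).indicator (fun _ => (1 : ℝ)) | m] := fun s hs => by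
    have := @ProbabilityTheory.condDistrib_ae_eq_condExp Ω Ω (ℕ → ℝ) _ _ _ mΩ P _ id
      (fun ω => ι (Y ω)) m s (measurable_id'' hm) hιY hs
    rwa [MeasurableSpace.comap_id] at this
  refine ⟨fun ω => ⟨(η ω).map r, Measure.isProbabilityMeasure_map hrm.aemeasurable⟩,
    measurable_probabilityMeasure_iff.2 fun B hB => ?_, fun B hB => ?_⟩
  · simp only [ProbabilityMeasure.coe_mk, Measure.map_apply hrm hB]
    exact (Measure.measurable_coe (hrm hB)).comp η.measurable
  · simp only [ProbabilityMeasure.coe_mk, map_measureReal_apply hrm hB]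
    refine (hη _ (hrm hB)).trans (condExp_congr_ae ?_)
    filter_upwards [hU] with ω hω
    simp only [indicator, mem_preimage, hr _ hω]

theorem IsCondLaw.martingale_integral {ℱ : Filtration I mΩ} {Y : Ω → E} (hY : Measurable Y)
    {κ : I → Ω → ProbabilityMeasure E} (hκ : ∀ t, IsCondLaw P (ℱ t) Y (κ t)) {G : E → ℝ}
    (hG : Measurable G) {C : ℝ} (hC : ∀ x, |G x| ≤ C) :
    Martingale (fun t ω => ∫ x, G x ∂(κ t ω : Measure E)) ℱ P := by
  refine ⟨fun t => (measurable_integral_probabilityMeasure hG (hκ t).measurable).stronglyMeasurable,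
    fun s t hst => ?_⟩
  refine (condExp_congr_ae ((hκ t).integral_ae_eq (ℱ.le t) hY hG hC)).trans ?_
  exact (condExp_condExp_of_le (ℱ.mono hst) (ℱ.le t)).trans
    ((hκ s).integral_ae_eq (ℱ.le s) hY hG hC).symm

end CondLaw

/-! ### Compactness of conditional laws along dyadic times -/

section GoodEvent

variable {E : Type u} [TopologicalSpace E] [MeasurableSpace E] [BorelSpace E]

/-- The probability measures that give mass at most `2 ^ (-(k + 1))` to the complement of `K k`,
for all `k`. -/
def tightSet (K : ℕ → Set E) : Set (ProbabilityMeasure E) :=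
  {μ | ∀ k, μ (K k)ᶜ ≤ (2⁻¹ : NNReal) ^ (k + 1)}

theorem isCompact_tightSet [MetrizableSpace E] {K : ℕ → Set E} (hK : ∀ k, IsCompact (K k)) :
    IsCompact (tightSet K) := by
  have := TopologicalSpace.metrizableSpaceMetric E
  refine isCompact_setOfPred_probabilityMeasure_mass_eq_compl_isCompact_le ?_ hK
    (.inl inferInstance)
  exact (tendsto_add_atTop_iff_nat 1).2
    (tendsto_pow_atTop_nhds_zero_of_lt_one (by simp) (by norm_num [← NNReal.coe_lt_coe]))

/-- A Dirac mass in `tightSet K` must sit in every `K k`, because the bounds are below `1` already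
for `k = 0`; so the set is the image of a compact set. This keeps the terminal condition `f(1) ∈
δ(E)` under limits. -/
theorem isClosed_tightSet_inter_range_diracProba [MetrizableSpace E] {K : ℕ → Set E}
    (hK : ∀ k, IsCompact (K k)) :
    IsClosed (tightSet K ∩ range (diracProba : E → ProbabilityMeasure E)) := by
  have h : tightSet K ∩ range (diracProba : E → ProbabilityMeasure E) =
      diracProba '' ⋂ k, K k := by
    ext μ
    constructor
    · rintro ⟨h, x, rfl⟩
      refine ⟨x, mem_iInter.2 fun k => ?_, rfl⟩
      by_contra hx
      have h1 := h k
      have h2 : (diracProba x : ProbabilityMeasure E) (K k)ᶜ = 1 := by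
        simp only [diracProba, ProbabilityMeasure.mk_apply,
          Measure.dirac_apply' _ (hK k).isClosed.measurableSet.compl]
        simp [hx]
      rw [h2] at h1
      exact h1.not_gt (pow_lt_one₀ (by simp) (by norm_num [← NNReal.coe_lt_coe]) k.succ_ne_zero)
    · rintro ⟨x, hx, rfl⟩
      refine ⟨fun k => ?_, x, rfl⟩
      have h2 : (diracProba x : ProbabilityMeasure E) (K k)ᶜ = 0 := by
        simp only [diracProba, ProbabilityMeasure.mk_apply,
          Measure.dirac_apply' _ (hK k).isClosed.measurableSet.compl]
        simp [mem_iInter.1 hx k]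
      rw [h2]
      exact zero_le
  rw [h]
  exact (((hK 0).of_isClosed_subset (isClosed_iInter fun k => (hK k).isClosed)
    (iInter_subset _ 0)).image continuous_diracProba).isClosed

variable {Ω : Type v} {mΩ : MeasurableSpace Ω} {P : Measure Ω} [IsProbabilityMeasure P]
  {ℱ : Filtration I mΩ}

/-- With probability close to one, conditional laws of a tight random variable along dyadic times
stay in a compact set and have bounded numbers of upcrossings. -/
theorem exists_good_event [MetrizableSpace E] {Y : Ω → E} (hY : Measurable Y)
    (hYt : TightRV P Y) {κ : I → Ω → ProbabilityMeasure E}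
    (hκ : ∀ t, IsCondLaw P (ℱ t) Y (κ t)) {ψ : ℕ → (E →ᵇ ℝ)}
    (hψ : ∀ j x, ψ j x ∈ Icc (0 : ℝ) 1) {ε : ℝ≥0∞} (hε : 0 < ε) :
    ∃ (K : ℕ → Set E) (N : ℕ → ℚ → ℚ → ℕ), (∀ k, IsCompact (K k)) ∧
      P {ω | ¬ ((∀ t ∈ dyadicPts, κ t ω ∈ tightSet K) ∧ ∀ j, ∀ a b : ℚ, a < b →
        ¬ UpChain (fun t => ∫ x, ψ j x ∂(κ t ω : Measure E)) dyadicPts a b (N j a b) 0)} ≤ ε := by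
  obtain ⟨δ, hδ, hδε⟩ := ENNReal.exists_pos_sum_of_countable' hε.ne' (ℕ ⊕ ℕ × ℚ × ℚ)
  -- The factor `2^{-(k+1)}` cancels the threshold in the maximal inequality, leaving `δ`.
  choose K hK hKP using fun k : ℕ => hYt ((2⁻¹ : NNReal) ^ (k + 1) * δ (.inl k))
    (ENNReal.mul_pos (by simp) (hδ _).ne')
  have hKm : ∀ k, MeasurableSet (K k)ᶜ := fun k => (hK k).isClosed.measurableSet.compl
  have h1 : ∀ k, P {ω | ∃ t ∈ dyadicPts, ((2⁻¹ : NNReal) ^ (k + 1) : NNReal) ≤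
      (κ t ω : Measure E).real (K k)ᶜ} ≤ δ (.inl k) := by
    intro k
    have hM := IsCondLaw.martingale_integral hY hκ (G := (K k)ᶜ.indicator 1)
      (measurable_one.indicator (hKm k)) (C := 1)
      fun x => by by_cases hx : x ∈ (K k)ᶜ <;> simp [hx]
    simp only [integral_indicator_one (hKm k)] at hM
    have h := measure_exists_dyadic_ge_le hM (fun _ _ => measureReal_nonneg)
      ((2⁻¹ : NNReal) ^ (k + 1))
    have hle : ENNReal.ofReal (∫ ω, (κ 1 ω : Measure E).real (K k)ᶜ ∂P) ≤
        ((2⁻¹ : NNReal) ^ (k + 1) : NNReal) * δ (.inl k) := by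
      rw [integral_congr_ae ((hκ 1).condExp _ (hKm k)), integral_condExp (ℱ.le 1)]
      rw [show ((fun _ => 1 : Ω → ℝ) = 1) from rfl, integral_indicator_one (hY (hKm k)),
        measureReal_def, ENNReal.ofReal_toReal (measure_ne_top _ _)]
      exact (hKP k).trans_eq (by push_cast; rfl)
    exact (ENNReal.mul_le_mul_iff_right (by simp) (by simp)).1 (h.trans hle)
  have h2 : ∀ j, ∀ a b : ℚ, ∃ N : ℕ, a < b →
      P {ω | UpChain (fun t => ∫ x, ψ j x ∂(κ t ω : Measure E)) dyadicPts a b N 0} ≤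
        δ (.inr (j, a, b)) := by
    intro j a b
    by_cases hab : a < b
    · have hab' : (a : ℝ) < b := by exact_mod_cast hab
      have hM := IsCondLaw.martingale_integral hY hκ (ψ j).continuous.measurable (C := 1)
        fun x => abs_le.2 ⟨by linarith [(hψ j x).1], (hψ j x).2⟩
      have hb : (ENNReal.ofReal (b - a)) ≠ 0 := by simpa using hab'
      -- Large enough that Doob's bound `(1 + |a|) / ((b - a) N)` falls below `δ`.
      obtain ⟨N, hN⟩ := ENNReal.exists_nat_gt (r := ENNReal.ofReal (1 + |(a : ℝ)|) /
          ENNReal.ofReal (b - a) / δ (.inr (j, a, b))) (ENNReal.div_lt_top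
            (ENNReal.div_lt_top ENNReal.ofReal_ne_top hb).ne (hδ _).ne').ne
      refine ⟨N, fun _ => ?_⟩
      have h := measure_upChain_le hM (fun t ω => ⟨integral_nonneg fun x => (hψ j x).1,
        (le_abs_self _).trans (abs_integral_probabilityMeasure_le (fun x => abs_le.2
          ⟨by linarith [(hψ j x).1], (hψ j x).2⟩) _)⟩) hab' N
      have hN0 : (N : ℝ≥0∞) ≠ 0 := (bot_le.trans_lt hN).ne'
      have hδt : δ (.inr (j, a, b)) ≠ ∞ :=
        ((ENNReal.le_tsum _).trans_lt (hδε.trans_le le_top)).ne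
      rw [mul_comm, ← ENNReal.le_div_iff_mul_le (.inl hb) (.inl ENNReal.ofReal_ne_top)] at h
      have h3 := (ENNReal.div_lt_iff (.inl (hδ _).ne') (.inl hδt)).1 hN
      exact (ENNReal.mul_le_mul_iff_right hN0 (by simp)).1 (h.trans h3.le)
    · exact ⟨0, fun h => absurd h hab⟩
  choose N hN using h2
  refine ⟨K, N, hK, ?_⟩
  let B : ℕ ⊕ ℕ × ℚ × ℚ → Set Ω := Sum.elim
    (fun k => {ω | ∃ t ∈ dyadicPts, ((2⁻¹ : NNReal) ^ (k + 1) : NNReal) ≤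
      (κ t ω : Measure E).real (K k)ᶜ})
    fun p => {ω | p.2.1 < p.2.2 ∧ UpChain (fun t => ∫ x, ψ p.1 x ∂(κ t ω : Measure E)) dyadicPts
      p.2.1 p.2.2 (N p.1 p.2.1 p.2.2) 0}
  have hB : ∀ i, P (B i) ≤ δ i := by
    rintro (k | ⟨j, a, b⟩)
    · exact h1 k
    · by_cases hab : a < b
      · exact (measure_mono fun ω hω => hω.2).trans (hN j a b hab)
      · simp [B, hab]
  refine (measure_mono fun ω hω => ?_).trans
    ((measure_iUnion_le B).trans ((ENNReal.tsum_le_tsum hB).trans hδε.le))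
  by_contra hωB
  refine hω ⟨fun t ht k => ?_, fun j a b hab h => hωB (mem_iUnion.2 ⟨.inr (j, a, b), hab, h⟩)⟩
  by_contra hk
  refine hωB (mem_iUnion.2 ⟨.inl k, t, ht, ?_⟩)
  exact (NNReal.coe_le_coe.2 (not_le.1 hk).le)

end GoodEvent

/-! ### Existence and tightness of prediction processes -/

theorem IsCondLaw.setIntegral_eq {Ω : Type v} {m mΩ : MeasurableSpace Ω} {P : Measure Ω}
    [IsProbabilityMeasure P] {E : Type u} [MeasurableSpace E] {Y : Ω → E}
    {κ : Ω → ProbabilityMeasure E} (h : IsCondLaw P m Y κ) (hm : m ≤ mΩ) (hY : Measurable Y)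
    {G : E → ℝ} (hG : Measurable G) {C : ℝ} (hC : ∀ x, |G x| ≤ C) {A : Set Ω}
    (hA : MeasurableSet[m] A) :
    ∫ ω in A, ∫ x, G x ∂(κ ω : Measure E) ∂P = ∫ ω in A, G (Y ω) ∂P := by
  rw [← integral_bind_probabilityMeasure (h.measurable.mono hm le_rfl) hG hC,
    h.bind_eq_map hm hY hA, integral_map hY.aemeasurable hG.aestronglyMeasurable]

namespace FilteredRV

variable {S : Type u} [TopologicalSpace S] [MeasurableSpace S] [BorelSpace S]
  (𝕏 : FilteredRV.{u, v} S)

theorem measurableSet_of_forall_gt {t : I} (ht : t ≠ 1) {A : Set 𝕏.Ω}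
    (h : ∀ s > t, MeasurableSet[𝕏.ℱ s] A) : MeasurableSet[𝕏.ℱ t] A := by
  have := 𝕏.rightCont
  have hne := neBot_nhdsWithin_inter_Ioi dense_univ ht
  rw [univ_inter] at hne
  refine Filtration.IsRightContinuous.measurableSet ?_
  rw [Filtration.rightCont_eq_of_neBot_nhdsGT]
  simp only [MeasurableSpace.measurableSet_iInf]
  exact h

/-- Completeness of the filtration: the two preimages differ by null sets, which belong to every
`ℱ_t`. -/
theorem measurable_of_ae_eq {E : Type w} [MeasurableSpace E] {f g : 𝕏.Ω → E} {t : I}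
    (hg : Measurable[𝕏.ℱ t] g) (hfg : f =ᵐ[𝕏.P] g) : Measurable[𝕏.ℱ t] f := by
  intro B hB
  have hN : 𝕏.P {ω | f ω ≠ g ω} = 0 := hfg
  have h : f ⁻¹' B = (g ⁻¹' B \ {ω | f ω ≠ g ω}) ∪ (f ⁻¹' B ∩ {ω | f ω ≠ g ω}) := by
    ext ω
    by_cases hω : f ω = g ω <;> simp [hω]
  rw [h]
  exact ((hg hB).diff (𝕏.complete t _ hN)).union
    (𝕏.complete t _ (measure_mono_null inter_subset_right hN))

theorem measurable_of_tendsto_ae {E : Type w} [TopologicalSpace E] [MetrizableSpace E]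
    [MeasurableSpace E] [BorelSpace E] {t : I} {g : ℕ → 𝕏.Ω → E} {f : 𝕏.Ω → E}
    (hg : ∀ k, Measurable[𝕏.ℱ t] (g k))
    (h : ∀ᵐ ω ∂𝕏.P, Tendsto (fun k => g k ω) atTop (𝓝 (f ω))) : Measurable[𝕏.ℱ t] f := by
  obtain ⟨ω₀⟩ : Nonempty 𝕏.Ω := nonempty_of_isProbabilityMeasure 𝕏.P
  classical
  let N : Set 𝕏.Ω := {ω | ¬ Tendsto (fun k => g k ω) atTop (𝓝 (f ω))}
  have hN : MeasurableSet[𝕏.ℱ t] N := 𝕏.complete t _ h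
  refine 𝕏.measurable_of_ae_eq (g := N.piecewise (fun _ => f ω₀) f) ?_ ?_
  · refine @measurable_of_tendsto_metrizable _ _ (𝕏.ℱ t) _ _ _ _
      (fun k => N.piecewise (fun _ => f ω₀) (g k)) _
      (fun k => Measurable.piecewise hN measurable_const (hg k)) (tendsto_pi_nhds.2 fun ω => ?_)
    by_cases hω : ω ∈ N
    · simp [hω]
    · simpa [hω] using not_not.1 hω
  · filter_upwards [h] with ω hω
    exact (piecewise_eq_of_notMem _ _ _ (not_not.2 hω)).symm

/-- For each `s > t` the grid points are eventually below `s`, so the limit is `ℱ_s`-measurable;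
right-continuity of the filtration then gives `ℱ_t`. -/
theorem measurable_of_tendsto_gridUp {E : Type w} [TopologicalSpace E] [MetrizableSpace E]
    [MeasurableSpace E] [BorelSpace E] {t : I} (ht : t ≠ 1) {g : I → 𝕏.Ω → E} {f : 𝕏.Ω → E}
    (hg : ∀ s, Measurable[𝕏.ℱ s] (g s))
    (h : ∀ᵐ ω ∂𝕏.P, Tendsto (fun k => g (gridUp k t) ω) atTop (𝓝 (f ω))) :
    Measurable[𝕏.ℱ t] f := by
  refine fun B hB => 𝕏.measurableSet_of_forall_gt ht fun s hs => ?_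
  obtain ⟨k₀, hk₀⟩ := eventually_atTop.1 (((tendsto_gridUp t).mono_right
    nhdsWithin_le_nhds).eventually (gt_mem_nhds hs))
  have : Measurable[𝕏.ℱ s] f := by
    refine 𝕏.measurable_of_tendsto_ae (g := fun k => g (gridUp (k + k₀) t)) (fun k => ?_) ?_
    · exact (hg _).mono (𝕏.ℱ.mono (hk₀ _ (Nat.le_add_left _ _)).le) le_rfl
    · filter_upwards [h] with ω hω
      exact (tendsto_add_atTop_iff_nat k₀).2 hω
  exact this hB

variable {𝕏} {E : Type u} [TopologicalSpace E] [MeasurableSpace E] [BorelSpace E]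

theorem measurable_one {E : Type w} [MeasurableSpace E] {Y : 𝕏.Ω → E} (hY : Measurable[𝕏.ℱ 1] Y) :
    Measurable Y :=
  hY.mono (𝕏.ℱ.le 1) le_rfl

variable [MetrizableSpace E] [SecondCountableTopology E]

theorem IsPredProc.isCondLaw {Y : 𝕏.Ω → E} {Z : 𝕏.Ω → PredPath E} (h : 𝕏.IsPredProc Y Z) (t : I) :
    IsCondLaw 𝕏.P (𝕏.ℱ t) Y fun ω => (Z ω).1.1 t :=
  ⟨BorelSpace.measurable_eq (α := ProbabilityMeasure E) ▸ h.adapted t, h.condLaw t⟩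

/-- Conditional laws are chosen separately for each time, with exactly `δ_Y` at time `1`, and `Z` is
their right limit along dyadic times. The good events make it càdlàg a.s., the usual conditions make
it adapted, and dominated convergence shows that it is still the conditional law. -/
theorem exists_isPredProc {Y : 𝕏.Ω → E} (hY : Measurable[𝕏.ℱ 1] Y) (hYt : TightRV 𝕏.P Y) :
    ∃ Z, 𝕏.IsPredProc Y Z := by
  have hY' := measurable_one hY
  have hex : ∀ t : I, ∃ κ : 𝕏.Ω → ProbabilityMeasure E, IsCondLaw 𝕏.P (𝕏.ℱ t) Y κ ∧
      (t = 1 → κ = fun ω => diracProba (Y ω)) := by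
    intro t
    by_cases ht : t = 1
    · subst ht
      exact ⟨_, isCondLaw_diracProba (𝕏.ℱ.le 1) hY, fun _ => rfl⟩
    · obtain ⟨κ, hκ⟩ := exists_isCondLaw (𝕏.ℱ.le t) hY' hYt
      exact ⟨κ, hκ, fun h => absurd h ht⟩
  choose κ hκ hκ1 using hex
  obtain ⟨ψ, hψ, hφ⟩ := exists_coordEmb_probabilityMeasure E
  have hae : ∀ᵐ ω ∂𝕏.P, ∃ z : PredPath E, z.1.1 1 = diracProba (Y ω) ∧ ∀ t, t ≠ 1 →
      Tendsto (fun s => κ s ω) (𝓝[dyadicPts ∩ Ioi t] t) (𝓝 (z.1.1 t)) := by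
    -- Outer measure suffices: the exceptional set lies in sets of arbitrarily small measure, so its
    -- measurability is not needed.
    have hle : ∀ k : ℕ, 𝕏.P {ω | ¬ ∃ z : PredPath E, z.1.1 1 = diracProba (Y ω) ∧ ∀ t, t ≠ 1 →
        Tendsto (fun s => κ s ω) (𝓝[dyadicPts ∩ Ioi t] t) (𝓝 (z.1.1 t))} ≤ (k : ℝ≥0∞)⁻¹ := by
      intro k
      obtain ⟨K, N, hK, hP⟩ := exists_good_event hY' hYt hκ hψ
        (ε := (k : ℝ≥0∞)⁻¹) (by simp)
      refine (measure_mono fun ω hω => not_imp_not.2 (fun hgood => ?_) hω).trans hP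
      obtain ⟨g, hg, -, hg1, hgt, -⟩ := hφ.exists_cadlag (isCompact_tightSet hK) dense_dyadicPts
        one_mem_dyadicPts hgood.1 fun j a b hab => ⟨_, hgood.2 j a b hab⟩
      have hg1' : g 1 = diracProba (Y ω) := hg1.trans (congrFun (hκ1 1 rfl) ω)
      exact ⟨⟨⟨g, hg⟩, Y ω, hg1'.symm⟩, hg1', hgt⟩
    exact le_antisymm (ge_of_tendsto' ENNReal.tendsto_inv_nat_nhds_zero hle) bot_le
  -- On the exceptional set the constant path `δ_Y` is used, so that the terminal value is `δ_Y` for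
  -- every `ω`.
  have hZex : ∀ ω, ∃ z : PredPath E, z.1.1 1 = diracProba (Y ω) ∧
      ((∃ z : PredPath E, z.1.1 1 = diracProba (Y ω) ∧ ∀ t, t ≠ 1 →
        Tendsto (fun s => κ s ω) (𝓝[dyadicPts ∩ Ioi t] t) (𝓝 (z.1.1 t))) → ∀ t, t ≠ 1 →
        Tendsto (fun s => κ s ω) (𝓝[dyadicPts ∩ Ioi t] t) (𝓝 (z.1.1 t))) := by
    intro ω
    by_cases h : ∃ z : PredPath E, z.1.1 1 = diracProba (Y ω) ∧ ∀ t, t ≠ 1 →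
        Tendsto (fun s => κ s ω) (𝓝[dyadicPts ∩ Ioi t] t) (𝓝 (z.1.1 t))
    · obtain ⟨z, h1, h2⟩ := h
      exact ⟨z, h1, fun _ => h2⟩
    · exact ⟨PredPath.const (Y ω), rfl, fun h' => absurd h' h⟩
  choose Z hZ1 hZ using hZex
  have hlim : ∀ t, t ≠ 1 → ∀ᵐ ω ∂𝕏.P,
      Tendsto (fun k => κ (gridUp k t) ω) atTop (𝓝 ((Z ω).1.1 t)) := fun t ht => by
    filter_upwards [hae] with ω hω
    refine (hZ ω hω t ht).comp (tendsto_nhdsWithin_iff.2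
      ⟨(tendsto_gridUp t).mono_right nhdsWithin_le_nhds, Eventually.of_forall fun k =>
        ⟨gridUp_mem k t, lt_gridUp k ht⟩⟩)
  have hZad : ∀ t, Measurable[𝕏.ℱ t] fun ω => (Z ω).1.1 t := by
    intro t
    rcases eq_or_ne t 1 with rfl | ht
    · simp only [hZ1]
      exact (isCondLaw_diracProba (P := 𝕏.P) (𝕏.ℱ.le 1) hY).measurable
    · exact 𝕏.measurable_of_tendsto_gridUp ht (fun s => (hκ s).measurable) (hlim t ht)
  have hlaw : ∀ t, IsCondLaw 𝕏.P (𝕏.ℱ t) Y fun ω => (Z ω).1.1 t := by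
    intro t
    rcases eq_or_ne t 1 with rfl | ht
    · simp only [hZ1]
      exact isCondLaw_diracProba (𝕏.ℱ.le 1) hY
    · refine isCondLaw_of_forall_integral (𝕏.ℱ.le t) hY' (hZad t) fun A hA f => ?_
      have h1 : Tendsto (fun k => ∫ ω in A, ∫ x, f x ∂(κ (gridUp k t) ω : Measure E) ∂𝕏.P) atTop
          (𝓝 (∫ ω in A, ∫ x, f x ∂((Z ω).1.1 t : Measure E) ∂𝕏.P)) := by
        refine tendsto_integral_of_dominated_convergence (fun _ => ‖f‖) (fun k => ?_)
          (integrable_const _) (fun k => ae_of_all _ fun ω => ?_) (ae_restrict_of_ae ?_)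
        · exact ((measurable_integral_probabilityMeasure f.continuous.measurable
            (hκ _).measurable).mono (𝕏.ℱ.le _) le_rfl).aestronglyMeasurable
        · exact abs_integral_probabilityMeasure_le f.norm_coe_le_norm _
        · filter_upwards [hlim t ht] with ω hω
          exact ((ProbabilityMeasure.continuous_integral_boundedContinuousFunction f).tendsto
            _).comp hω
      -- Since `t ≤ gridUp k t`, the event `A` is also known at the grid time, and the integrals do
      -- not depend on `k`.
      refine tendsto_nhds_unique h1 (tendsto_const_nhds.congr fun k => ?_)
      exact ((hκ _).setIntegral_eq (𝕏.ℱ.le _) hY' f.continuous.measurable f.norm_coe_le_norm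
        (𝕏.ℱ.mono (le_gridUp k t) _ hA)).symm
  refine ⟨Z, ?_, fun t => ?_, fun t => (hlaw t).condExp⟩
  · exact Measurable.subtype_mk (@CadlagPath.measurable_of_eval _ _ _ _ _ _ _ (𝕏.ℱ 1)
      (fun ω => (Z ω).1) univ dense_univ (mem_univ _)
      fun t _ => (hZad t).mono (𝕏.ℱ.mono unitInterval.le_one') le_rfl)
  · exact BorelSpace.measurable_eq (α := ProbabilityMeasure E) ▸ hZad t

variable (𝕏) in
theorem isPredProc_predProc {Y : 𝕏.Ω → E}
    (hY : Measurable[𝕏.ℱ 1] Y) (hYt : TightRV 𝕏.P Y) : 𝕏.IsPredProc Y (𝕏.predProc Y) := by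
  have h := exists_isPredProc hY hYt
  rw [predProc, dif_pos h]
  exact h.choose_spec

/-- Prediction processes of tight random variables are tight. -/
theorem IsPredProc.tightRV {Y : 𝕏.Ω → E} {Z : 𝕏.Ω → PredPath E} (h : 𝕏.IsPredProc Y Z)
    (hY : Measurable Y) (hYt : TightRV 𝕏.P Y) : TightRV 𝕏.P Z := by
  intro ε hε
  have hε2 : 0 < ε / 2 := ENNReal.half_pos hε.ne'
  obtain ⟨ψ, hψ, hφ⟩ := exists_coordEmb_probabilityMeasure E
  obtain ⟨K, N, hK, hP⟩ := exists_good_event hY hYt h.isCondLaw hψ hε2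
  let _ : MeasurableSpace (Lp ℝ 1 coordMeasure) := borel _
  have : BorelSpace (Lp ℝ 1 coordMeasure) := ⟨rfl⟩
  have hZm : Measurable fun ω => (Z ω).1 :=
    measurable_subtype_coe.comp (measurable_one h.measurable)
  -- `L¹` is Polish, so the law of the coordinates of the path is tight there.
  obtain ⟨C, hC, hCP⟩ := tightRV_of_polish
    (hφ.isEmbedding_toL1.continuous.measurable.comp hZm) (P := 𝕏.P) (ε / 2) hε2
  have hcomp := hφ.isCompact_setOf_path (isCompact_tightSet hK)
    (isClosed_tightSet_inter_range_diracProba hK) hC N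
  -- Compactness passes to the subspace because all paths in the compact set end in a Dirac mass.
  refine ⟨Subtype.val ⁻¹' _, IsInducing.subtypeVal.isCompact_preimage' hcomp ?_, ?_⟩
  · rintro f ⟨-, hf, -⟩
    exact ⟨⟨f, hf.2⟩, rfl⟩
  · refine (measure_mono fun ω hω => ?_).trans ((measure_union_le _ _).trans
      ((add_le_add hP hCP).trans_eq (ENNReal.add_halves ε)))
    by_contra hω'
    rw [mem_union, not_or] at hω'
    obtain ⟨hgood, hωC⟩ := hω'
    replace hgood := not_not.1 hgood
    -- Right-continuity carries the bounds from dyadic times to all times, here for the values and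
    -- below for the upcrossings.
    have hKt : ∀ t, (Z ω).1.1 t ∈ tightSet K := fun t =>
      (isCompact_tightSet hK).isClosed.mem_of_tendsto
        (((Z ω).1.2.1 t).tendsto.comp (tendsto_gridUp t))
        (Eventually.of_forall fun k => hgood.1 _ (gridUp_mem k t))
    refine hω ⟨hKt, ⟨hKt 1, (Z ω).2⟩, fun j a b hab hch => hgood.2 j a b hab ?_, not_not.1 hωC⟩
    refine hch.of_rightLimit dense_dyadicPts one_mem_dyadicPts rfl fun t _ => ?_
    exact ((hφ.continuous j).tendsto _).comp (((Z ω).1.2.1 t).tendsto.mono_left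
      (nhdsWithin_mono _ fun s hs => mem_Ici.2 (mem_Ioi.1 hs.2).le))

end FilteredRV

instance PredPath.instMetrizableSpace {E : Type u} [TopologicalSpace E] [MetrizableSpace E]
    [SecondCountableTopology E] [MeasurableSpace E] [BorelSpace E] :
    MetrizableSpace (PredPath E) :=
  IsEmbedding.subtypeVal.metrizableSpace

instance PredPath.instSecondCountableTopology {E : Type u} [TopologicalSpace E]
    [MetrizableSpace E] [SecondCountableTopology E] [MeasurableSpace E] [BorelSpace E] :
    SecondCountableTopology (PredPath E) :=
  IsEmbedding.subtypeVal.secondCountableTopology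

/-! ### Lusin spaces and the iterated prediction processes -/

section Lusin

variable {S : Type u} [TopologicalSpace S] [LusinSpace S]

instance LusinSpace.metrizableSpace : MetrizableSpace S :=
  let ⟨_, _, _, _, h, _⟩ := LusinSpace.exists_embedding (S := S)
  h.metrizableSpace

instance LusinSpace.secondCountableTopology : SecondCountableTopology S :=
  let ⟨_, _, _, _, h, _⟩ := LusinSpace.exists_embedding (S := S)
  h.secondCountableTopology

variable [MeasurableSpace S] [BorelSpace S]

/-- Inner regularity in the ambient Polish space, applied to the Borel range, gives a compact set
inside the range, whose preimage is compact. -/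
theorem LusinSpace.tightRV {Ω : Type v} {mΩ : MeasurableSpace Ω} {P : Measure Ω}
    [IsFiniteMeasure P] {X : Ω → S} (hX : Measurable X) : TightRV P X := by
  intro ε hε
  obtain ⟨S', _, _, ι, hι, hr⟩ := LusinSpace.exists_embedding (S := S)
  let _ : MeasurableSpace S' := borel S'
  have : BorelSpace S' := ⟨rfl⟩
  have hιX : Measurable fun ω => ι (X ω) := hι.continuous.measurable.comp hX
  obtain ⟨K, hKr, hK, hKP⟩ := hr.exists_isCompact_sdiff_lt
    (measure_ne_top (P.map fun ω => ι (X ω)) _) hε.ne'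
  refine ⟨ι ⁻¹' K, hι.isInducing.isCompact_preimage' hK hKr, le_trans ?_ hKP.le⟩
  rw [Measure.map_apply hιX (hr.diff hK.isClosed.measurableSet)]
  exact measure_mono fun ω hω => ⟨mem_range_self _, hω⟩

instance predSpace.instMetrizableSpace (n : ℕ) : MetrizableSpace (predSpace S n) := by
  suffices h : MetrizableSpace (predSpace S n) ∧ SecondCountableTopology (predSpace S n) from h.1
  induction n with
  | zero => exact ⟨inferInstanceAs (MetrizableSpace S), inferInstanceAs (SecondCountableTopology S)⟩
  | succ n ih =>
    obtain ⟨_, _⟩ := ih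
    exact ⟨inferInstanceAs (MetrizableSpace (PredPath (predSpace S n))),
      inferInstanceAs (SecondCountableTopology (PredPath (predSpace S n)))⟩

instance predSpace.instSecondCountableTopology (n : ℕ) :
    SecondCountableTopology (predSpace S n) := by
  induction n with
  | zero => exact inferInstanceAs (SecondCountableTopology S)
  | succ n ih => exact inferInstanceAs (SecondCountableTopology (PredPath (predSpace S n)))

namespace FilteredRV

variable (𝕏 : FilteredRV.{u, v} S)

/-- Tightness of `pp^n` is what makes the next prediction process exist, so that the default branch
of `predProc` is never taken; it is inherited by `pp^{n+1}`. -/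
theorem pp_measurable_and_tightRV (n : ℕ) :
    Measurable[𝕏.ℱ 1] (𝕏.pp n) ∧ TightRV 𝕏.P (𝕏.pp n) := by
  induction n with
  | zero => exact ⟨𝕏.measurable_X, LusinSpace.tightRV (S := S) (measurable_one 𝕏.measurable_X)⟩
  | succ n ih =>
    have h := 𝕏.isPredProc_predProc ih.1 ih.2
    exact ⟨h.measurable, h.tightRV (measurable_one ih.1) ih.2⟩

theorem measurable_pp (n : ℕ) : Measurable (𝕏.pp n) :=
  measurable_one (𝕏.pp_measurable_and_tightRV n).1

theorem isPredProc_ppPath (n : ℕ) : 𝕏.IsPredProc (𝕏.pp n) (𝕏.ppPath n) :=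
  𝕏.isPredProc_predProc (𝕏.pp_measurable_and_tightRV n).1 (𝕏.pp_measurable_and_tightRV n).2

end FilteredRV

end Lusin

/-! ### Families of functions that generate the `σ`-algebra -/

/-- A family of measurable functions closed under continuous operations. -/
structure ClosedUnderContinuous {M : Type u} [MeasurableSpace M] (A : Set (M → ℝ)) : Prop where
  measurable : ∀ G ∈ A, Measurable G
  comp₂ : ∀ G ∈ A, ∀ H ∈ A, ∀ g : ℝ × ℝ → ℝ, Continuous g → (fun x => g (G x, H x)) ∈ A

/-- The positivity sets of a family of functions. -/
def posSets {M : Type u} (A : Set (M → ℝ)) : Set (Set M) := {s | ∃ G ∈ A, s = {x | 0 < G x}}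

namespace ClosedUnderContinuous

variable {M : Type u} [mM : MeasurableSpace M] {A : Set (M → ℝ)}

theorem comp (hA : ClosedUnderContinuous A) {G : M → ℝ} (hG : G ∈ A) {g : ℝ → ℝ}
    (hg : Continuous g) : (fun x => g (G x)) ∈ A :=
  hA.comp₂ G hG G hG (fun p => g p.1) (hg.comp continuous_fst)

theorem isPiSystem_posSets (hA : ClosedUnderContinuous A) : IsPiSystem (posSets A) := by
  rintro _ ⟨G, hG, rfl⟩ _ ⟨H, hH, rfl⟩ -
  refine ⟨_, hA.comp₂ G hG H hH (fun p => min p.1 p.2) (by fun_prop), ?_⟩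
  ext x
  simp

theorem measurable_generateFrom (hA : ClosedUnderContinuous A) {G : M → ℝ} (hG : G ∈ A) :
    Measurable[MeasurableSpace.generateFrom (posSets A)] G := by
  refine measurable_of_Ioi fun a => ?_
  refine MeasurableSpace.measurableSet_generateFrom
    ⟨_, hA.comp hG (g := fun y => y - a) (by fun_prop), ?_⟩
  ext x
  simp

/-- The probability of a positivity set is a limit of integrals over the family. -/
theorem tendsto_integral (hA : ClosedUnderContinuous A) {G : M → ℝ} (hG : G ∈ A)
    (μ : Measure M) [IsFiniteMeasure μ] :
    Tendsto (fun k : ℕ => ∫ x, min 1 (k * max (G x) 0) ∂μ) atTop (𝓝 (μ.real {x | 0 < G x})) := by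
  have hm : MeasurableSet {x | 0 < G x} := measurableSet_lt measurable_const (hA.measurable G hG)
  rw [← integral_indicator_one hm]
  refine tendsto_integral_of_dominated_convergence (fun _ => 1) (fun k => ?_)
    (integrable_const _) (fun k => ae_of_all _ fun x => ?_) (ae_of_all _ fun x => ?_)
  · exact (hA.measurable _ (hA.comp hG (g := fun y => min 1 (k * max y 0))
      (by fun_prop))).aestronglyMeasurable
  · have h0 : 0 ≤ min 1 ((k : ℝ) * max (G x) 0) := le_min zero_le_one (by positivity)
    rw [Real.norm_of_nonneg h0]
    exact min_le_left _ _
  · by_cases hx : 0 < G x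
    · have h1 : {x | 0 < G x}.indicator (1 : M → ℝ) x = 1 := by simp [hx]
      rw [h1, max_eq_left hx.le]
      have h2 := (tendsto_natCast_atTop_atTop (R := ℝ)).atTop_mul_const hx
      refine tendsto_const_nhds.congr' ?_
      filter_upwards [h2.eventually_ge_atTop 1] with k hk
      exact (min_eq_left hk).symm
    · have h1 : {x | 0 < G x}.indicator (1 : M → ℝ) x = 0 := by simp [hx]
      rw [h1, max_eq_right (not_lt.1 hx)]
      simp

/-- Masses of positivity sets are limits of integrals over the family, and these sets form a
π-system because `min` is continuous. -/
theorem measure_eq (hA : ClosedUnderContinuous A)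
    (hgen : mM ≤ MeasurableSpace.generateFrom (posSets A)) {μ ν : Measure M}
    [IsProbabilityMeasure μ] [IsProbabilityMeasure ν] (h : ∀ G ∈ A, ∫ x, G x ∂μ = ∫ x, G x ∂ν) :
    μ = ν := by
  refine ext_of_generate_finite _ (le_antisymm hgen (MeasurableSpace.generateFrom_le ?_))
    hA.isPiSystem_posSets ?_ (by simp)
  · rintro _ ⟨G, hG, rfl⟩
    exact measurableSet_lt measurable_const (hA.measurable G hG)
  · rintro _ ⟨G, hG, rfl⟩
    have h1 := hA.tendsto_integral hG μ
    have h2 := hA.tendsto_integral hG ν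
    have h3 : ∀ k : ℕ, ∫ x, min 1 (k * max (G x) 0) ∂μ = ∫ x, min 1 (k * max (G x) 0) ∂ν := fun k =>
      h _ (hA.comp hG (g := fun y => min 1 (k * max y 0)) (by fun_prop))
    simp only [h3] at h1
    exact (measureReal_eq_measureReal_iff).1 (tendsto_nhds_unique h1 h2)

/-- Same π-system as for uniqueness: the mass of a positivity set is a pointwise limit of measurable
integrals. -/
theorem measurable_of_integral (hA : ClosedUnderContinuous A)
    (hgen : mM ≤ MeasurableSpace.generateFrom (posSets A)) {Ω : Type v} {mΩ : MeasurableSpace Ω}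
    {κ : Ω → ProbabilityMeasure M}
    (h : ∀ G ∈ A, Measurable fun ω => ∫ x, G x ∂(κ ω : Measure M)) : Measurable κ := by
  refine Measurable.subtype_mk (f := fun ω => (κ ω : Measure M))
    (Measurable.measure_of_isPiSystem_of_isProbabilityMeasure
      (le_antisymm hgen (MeasurableSpace.generateFrom_le ?_)) hA.isPiSystem_posSets ?_)
  · rintro _ ⟨G, hG, rfl⟩
    exact measurableSet_lt measurable_const (hA.measurable G hG)
  · rintro _ ⟨G, hG, rfl⟩
    have h1 : Measurable fun ω => (κ ω : Measure M).real {x | 0 < G x} :=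
      measurable_of_tendsto_metrizable (f := fun (k : ℕ) ω =>
        ∫ x, min 1 (k * max (G x) 0) ∂(κ ω : Measure M))
        (fun k => h _ (hA.comp hG (g := fun y => min 1 (k * max y 0)) (by fun_prop)))
        (tendsto_pi_nhds.2 fun ω => hA.tendsto_integral hG _)
    simpa [measureReal_def] using h1.ennreal_ofReal

end ClosedUnderContinuous

/-! ### Adapted functions as functions of the prediction processes -/

section Adapted

variable {S : Type u} [TopologicalSpace S] [MeasurableSpace S] [BorelSpace S]

/-- The bounded measurable functions that represent, on `𝕏` through `p` and on `𝕐` through `q`, an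
adapted function of rank at most `r` with times in `T`. -/
def repFun (𝕏 : FilteredRV.{u, v} S) (𝕐 : FilteredRV.{u, w} S) (T : Set I) (r : ℕ∞) {M : Type u}
    [MeasurableSpace M] (p : 𝕏.Ω → M) (q : 𝕐.Ω → M) : Set (M → ℝ) :=
  {G | Measurable G ∧ (∃ C, ∀ x, |G x| ≤ C) ∧ ∃ f : AdaptedFun S, (f.rank : ℕ∞) ≤ r ∧
    f.times ⊆ T ∧ f.value 𝕏 =ᵐ[𝕏.P] (fun ω => G (p ω)) ∧ f.value 𝕐 =ᵐ[𝕐.P] fun ω => G (q ω)}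

theorem closedUnderContinuous_repFun (𝕏 : FilteredRV.{u, v} S) (𝕐 : FilteredRV.{u, w} S)
    (T : Set I) (r : ℕ∞) {M : Type u} [MeasurableSpace M] (p : 𝕏.Ω → M) (q : 𝕐.Ω → M) :
    ClosedUnderContinuous (repFun 𝕏 𝕐 T r p q) := by
  refine ⟨fun G hG => hG.1, ?_⟩
  rintro G ⟨hG, ⟨C, hC⟩, f, hfr, hfT, hfX, hfY⟩ H ⟨hH, ⟨D, hD⟩, f', hfr', hfT', hfX', hfY'⟩ g hg
  have hC' : -|C| ≤ |C| := neg_le_self (abs_nonneg C)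
  have hD' : -|D| ≤ |D| := neg_le_self (abs_nonneg D)
  -- `g` may be unbounded, but only its values on a box containing the range of `(G, H)` matter.
  -- Projecting onto the box gives a bounded continuous function; `|C|` and `|D|` keep the box
  -- nonempty.
  let b : (Icc (-|C|) |C| × Icc (-|D|) |D|) →ᵇ ℝ := BoundedContinuousFunction.mkOfCompact
    ⟨fun x => g (x.1, x.2), by fun_prop⟩
  let g' : (Fin 2 → ℝ) →ᵇ ℝ := b.compContinuous
    ⟨fun v => (projIcc _ _ hC' (v 0), projIcc _ _ hD' (v 1)),
      (continuous_projIcc.comp (continuous_apply 0)).prodMk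
        (continuous_projIcc.comp (continuous_apply 1))⟩
  have hg' : ∀ x, g' ![G x, H x] = g (G x, H x) := fun x => by
    have h1 := abs_le.1 ((hC x).trans (le_abs_self C))
    have h2 := abs_le.1 ((hD x).trans (le_abs_self D))
    change g ((projIcc _ _ hC' (G x) : ℝ), (projIcc _ _ hD' (H x) : ℝ)) = _
    rw [projIcc_of_mem hC' h1, projIcc_of_mem hD' h2]
  refine ⟨hg.measurable.comp (hG.prodMk hH), ⟨‖g'‖, fun x => ?_⟩,
    AdaptedFun.comp 1 g' ![f, f'], ?_, ?_, ?_, ?_⟩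
  · change |g (G x, H x)| ≤ _
    rw [← hg']
    exact g'.norm_coe_le_norm _
  · simp only [AdaptedFun.rank]
    induction r using ENat.recTopCoe with
    | top => exact le_top
    | coe r =>
      rw [Nat.cast_le] at hfr hfr' ⊢
      refine Finset.sup_le fun i _ => ?_
      fin_cases i
      · exact hfr
      · exact hfr'
  · simp only [AdaptedFun.times]
    refine iUnion_subset fun i => ?_
    fin_cases i
    · exact hfT
    · exact hfT'
  · filter_upwards [hfX, hfX'] with ω h1 h2
    rw [← hg', ← h1, ← h2]
    refine congrArg g' (funext fun i => ?_)
    fin_cases i <;> rfl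
  · filter_upwards [hfY, hfY'] with ω h1 h2
    rw [← hg', ← h1, ← h2]
    refine congrArg g' (funext fun i => ?_)
    fin_cases i <;> rfl

theorem repFun_mono (𝕏 : FilteredRV.{u, v} S) (𝕐 : FilteredRV.{u, w} S) {T : Set I} {r s : ℕ∞}
    (hrs : r ≤ s) {M : Type u} [MeasurableSpace M] {p : 𝕏.Ω → M} {q : 𝕐.Ω → M} :
    repFun 𝕏 𝕐 T r p q ⊆ repFun 𝕏 𝕐 T s p q :=
  fun _ ⟨hG, hC, f, hr, h⟩ => ⟨hG, hC, f, hr.trans hrs, h⟩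

namespace AdaptedFun

theorem integral_eq_of_mem_repFun {𝕏 : FilteredRV.{u, v} S} {𝕐 : FilteredRV.{u, w} S}
    {T : Set I} {r : ℕ∞} (h : ∀ f : AdaptedFun S, (f.rank : ℕ∞) ≤ r → f.times ⊆ T →
      f.expectation 𝕏 = f.expectation 𝕐) {M : Type u} [MeasurableSpace M] {p : 𝕏.Ω → M}
    {q : 𝕐.Ω → M} {G : M → ℝ} (hG : G ∈ repFun 𝕏 𝕐 T r p q) :
    ∫ ω, G (p ω) ∂𝕏.P = ∫ ω, G (q ω) ∂𝕐.P := by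
  obtain ⟨-, -, f, hr, hT, hX, hY⟩ := hG
  rw [← integral_congr_ae hX, ← integral_congr_ae hY]
  exact h f hr hT

/-- If the represented functions generate the Borel sets, then equal expectations imply equal
laws. -/
theorem map_eq_of_expectation_eq {𝕏 : FilteredRV.{u, v} S} {𝕐 : FilteredRV.{u, w} S}
    {T : Set I} {r : ℕ∞} (h : ∀ f : AdaptedFun S, (f.rank : ℕ∞) ≤ r → f.times ⊆ T →
      f.expectation 𝕏 = f.expectation 𝕐) {M : Type u} [mM : MeasurableSpace M] {p : 𝕏.Ω → M}
    {q : 𝕐.Ω → M} (hp : Measurable p) (hq : Measurable q)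
    (hgen : mM ≤ MeasurableSpace.generateFrom (posSets (repFun 𝕏 𝕐 T r p q))) :
    𝕏.P.map p = 𝕐.P.map q := by
  have := Measure.isProbabilityMeasure_map (μ := 𝕏.P) hp.aemeasurable
  have := Measure.isProbabilityMeasure_map (μ := 𝕐.P) hq.aemeasurable
  refine (closedUnderContinuous_repFun 𝕏 𝕐 T r p q).measure_eq hgen fun G hG => ?_
  rw [integral_map hp.aemeasurable hG.1.aestronglyMeasurable,
    integral_map hq.aemeasurable hG.1.aestronglyMeasurable]
  exact integral_eq_of_mem_repFun h hG

end AdaptedFun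

/-! ### Prediction processes determine the values of adapted functions -/

section

variable {E : Type u} [TopologicalSpace E] [MetrizableSpace E] [SecondCountableTopology E]
  [MeasurableSpace E] [BorelSpace E]

/-- The point at which a path in `{f ∈ D(𝒫(E)) : f(1) ∈ δ(E)}` terminates. -/
noncomputable def PredPath.terminal (z : PredPath E) : E := z.2.choose

omit [MetrizableSpace E] [SecondCountableTopology E] in
theorem PredPath.diracProba_terminal (z : PredPath E) : diracProba z.terminal = z.1.1 1 :=
  z.2.choose_spec

theorem PredPath.measurable_eval (t : I) : Measurable fun z : PredPath E => z.1.1 t :=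
  (CadlagPath.measurable_eval t).comp measurable_subtype_coe

/-- The terminal Dirac mass gives `B` mass `1` exactly when its point lies in `B`. -/
theorem PredPath.measurable_terminal : Measurable (PredPath.terminal (E := E)) := by
  intro B hB
  have h : PredPath.terminal ⁻¹' B = {z : PredPath E | (z.1.1 1 : Measure E) B = 1} := by
    ext z
    rw [mem_ofPred_eq, ← z.diracProba_terminal]
    simp only [diracProba, ProbabilityMeasure.coe_mk, Measure.dirac_apply' _ hB, mem_preimage]
    by_cases hz : z.terminal ∈ B <;> simp [hz]
  rw [h]
  exact measurable_probabilityMeasure_iff.1 (PredPath.measurable_eval 1) B hB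
    (measurableSet_singleton 1)

/-- Given `ℱ_1` the variable `Y` is known, so its conditional law at time `1` is `δ_Y`. The a.e.
identities hold one function at a time, hence the countably many coordinates. -/
theorem FilteredRV.IsPredProc.terminal_ae_eq {𝕏 : FilteredRV.{u, v} S} {Y : 𝕏.Ω → E}
    {Z : 𝕏.Ω → PredPath E} (h : 𝕏.IsPredProc Y Z) (hY : Measurable[𝕏.ℱ 1] Y) :
    (fun ω => (Z ω).terminal) =ᵐ[𝕏.P] Y := by
  obtain ⟨φ, hφ⟩ := exists_coordEmb E
  have hj : ∀ j, ∀ᵐ ω ∂𝕏.P, φ j (Z ω).terminal = φ j (Y ω) := fun j => by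
    have hm : Measurable (φ j) := (hφ.continuous j).measurable
    have h1 := (h.isCondLaw 1).integral_ae_eq (𝕏.ℱ.le 1) (FilteredRV.measurable_one hY) hm
      (hφ.abs_le_one j)
    rw [condExp_of_stronglyMeasurable (𝕏.ℱ.le 1) (f := fun ω => φ j (Y ω))
      (hm.comp hY).stronglyMeasurable (Integrable.of_bound
        (hm.comp (FilteredRV.measurable_one hY)).aestronglyMeasurable 1
        (ae_of_all _ fun ω => hφ.abs_le_one j _))] at h1
    filter_upwards [h1] with ω hω
    rw [← hω, ← (Z ω).diracProba_terminal]
    exact (integral_dirac _ _).symm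
  filter_upwards [ae_all_iff.2 hj] with ω hω
  exact hφ.eq_of_forall hω

end

variable [LusinSpace S]

theorem FilteredRV.condExp_ae_eq_integral_ppPath (𝕏 : FilteredRV.{u, v} S) (n : ℕ) (t : I)
    {f : 𝕏.Ω → ℝ} {G : predSpace S n → ℝ} (hG : Measurable G) {C : ℝ} (hC : ∀ x, |G x| ≤ C)
    (hf : f =ᵐ[𝕏.P] fun ω => G (𝕏.pp n ω)) :
    𝕏.P[f | 𝕏.ℱ t] =ᵐ[𝕏.P]
      fun ω => ∫ x, G x ∂((𝕏.ppPath n ω).1.1 t : Measure (predSpace S n)) :=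
  (condExp_congr_ae hf).trans
    (((𝕏.isPredProc_ppPath n).isCondLaw t).integral_ae_eq (𝕏.ℱ.le t) (𝕏.measurable_pp n) hG
      hC).symm

/-- Induction on the term. Allowing every `n` above the rank brings the arguments of a composition
to a common level. For `(f|t)` the new function is `z ↦ ∫ G dz_t`. -/
theorem AdaptedFun.exists_value_ae_eq (𝕏 : FilteredRV.{u, v} S) (𝕐 : FilteredRV.{u, w} S)
    (f : AdaptedFun S) : ∀ n : ℕ, f.rank ≤ n → ∃ G : predSpace S n → ℝ, Measurable G ∧
      (∃ C, ∀ x, |G x| ≤ C) ∧ f.value 𝕏 =ᵐ[𝕏.P] (fun ω => G (𝕏.pp n ω)) ∧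
      f.value 𝕐 =ᵐ[𝕐.P] fun ω => G (𝕐.pp n ω) := by
  induction f with
  | base f =>
    intro n _
    -- `X` is recovered from `pp^n` by taking terminal points `n` times.
    induction n with
    | zero =>
      exact ⟨f, f.continuous.measurable, ⟨‖f‖, f.norm_coe_le_norm⟩, ae_eq_refl _, ae_eq_refl _⟩
    | succ n ih =>
      obtain ⟨G, hG, ⟨C, hC⟩, hX, hY⟩ := ih (Nat.zero_le _)
      refine ⟨fun z : PredPath (predSpace S n) => G z.terminal,
        hG.comp PredPath.measurable_terminal,
        ⟨C, fun _ => hC _⟩, ?_, ?_⟩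
      · filter_upwards [hX, (𝕏.isPredProc_ppPath n).terminal_ae_eq
          (𝕏.pp_measurable_and_tightRV n).1] with ω h1 h2
        exact h1.trans (congrArg G h2.symm)
      · filter_upwards [hY, (𝕐.isPredProc_ppPath n).terminal_ae_eq
          (𝕐.pp_measurable_and_tightRV n).1] with ω h1 h2
        exact h1.trans (congrArg G h2.symm)
  | comp m g f ih =>
    intro n hn
    choose G hG hC hX hY using fun i =>
      ih i n ((Finset.le_sup (f := fun i => (f i).rank) (Finset.mem_univ i)).trans hn)
    refine ⟨fun x => g fun i => G i x, g.continuous.measurable.comp (measurable_pi_lambda _ hG),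
      ⟨‖g‖, fun _ => g.norm_coe_le_norm _⟩, ?_, ?_⟩
    · filter_upwards [ae_all_iff.2 hX] with ω h
      exact congrArg g (funext h)
    · filter_upwards [ae_all_iff.2 hY] with ω h
      exact congrArg g (funext h)
  | cond f t ih =>
    intro n hn
    obtain ⟨n, rfl⟩ : ∃ k, n = k + 1 :=
      Nat.exists_eq_succ_of_ne_zero ((Nat.succ_pos f.rank).trans_le hn).ne'
    obtain ⟨G, hG, ⟨C, hC⟩, hX, hY⟩ := ih n (Nat.le_of_succ_le_succ hn)
    exact ⟨fun z : PredPath (predSpace S n) => ∫ x, G x ∂(z.1.1 t : Measure (predSpace S n)),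
      measurable_integral_probabilityMeasure hG (PredPath.measurable_eval t),
      ⟨C, fun _ => abs_integral_probabilityMeasure_le hC _⟩,
      𝕏.condExp_ae_eq_integral_ppPath n t hG hC hX, 𝕐.condExp_ae_eq_integral_ppPath n t hG hC hY⟩

theorem AdaptedFun.expectation_eq_of_map_pp_eq {𝕏 : FilteredRV.{u, v} S}
    {𝕐 : FilteredRV.{u, w} S} {n : ℕ} (h : 𝕏.P.map (𝕏.pp n) = 𝕐.P.map (𝕐.pp n))
    {f : AdaptedFun S} (hf : f.rank ≤ n) : f.expectation 𝕏 = f.expectation 𝕐 := by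
  obtain ⟨G, hG, -, hX, hY⟩ := f.exists_value_ae_eq 𝕏 𝕐 n hf
  rw [expectation, expectation, integral_congr_ae hX, integral_congr_ae hY,
    ← integral_map (𝕏.measurable_pp n).aemeasurable hG.aestronglyMeasurable, h,
    integral_map (𝕐.measurable_pp n).aemeasurable hG.aestronglyMeasurable]

/-! ### Adapted functions determine the laws of prediction processes -/

section

variable (𝕏 : FilteredRV.{u, v} S) (𝕐 : FilteredRV.{u, w} S) {T : Set I}

/-- The integral represents `(f|t)` when `G` represents `f`. The abstract evaluation map `e` serves
both `M_{n+1}` and `M_∞`. -/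
theorem integral_mem_repFun {n : ℕ} {r : ℕ∞} {G : predSpace S n → ℝ}
    (hG : G ∈ repFun 𝕏 𝕐 T r (𝕏.pp n) (𝕐.pp n)) {t : I} (ht : t ∈ T) {M : Type u}
    [MeasurableSpace M] {p : 𝕏.Ω → M} {q : 𝕐.Ω → M} {e : M → ProbabilityMeasure (predSpace S n)}
    (he : Measurable e) (hp : ∀ ω, e (p ω) = (𝕏.ppPath n ω).1.1 t)
    (hq : ∀ ω, e (q ω) = (𝕐.ppPath n ω).1.1 t) :
    (fun z => ∫ x, G x ∂(e z : Measure (predSpace S n))) ∈ repFun 𝕏 𝕐 T (r + 1) p q := by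
  obtain ⟨hG, ⟨C, hC⟩, f, hr, hT, hX, hY⟩ := hG
  refine ⟨measurable_integral_probabilityMeasure hG he,
    ⟨C, fun _ => abs_integral_probabilityMeasure_le hC _⟩, f.cond t, ?_,
    union_subset hT (singleton_subset_iff.2 ht), ?_, ?_⟩
  · rw [AdaptedFun.rank, Nat.cast_succ]
    gcongr
  · simp only [hp]
    exact 𝕏.condExp_ae_eq_integral_ppPath n t hG hC hX
  · simp only [hq]
    exact 𝕐.condExp_ae_eq_integral_ppPath n t hG hC hY

/-- It suffices that the identity is measurable from the generated `σ`-algebra to the Borel one.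
This is tested on evaluations at times in `T`, and these on integrals of the family at level `n`,
which lie in the family at level `n + 1`. -/
theorem predSpace_le_generateFrom (hT : Dense T) (h1 : 1 ∈ T) (n : ℕ) :
    (predSpace S n).meas ≤
      MeasurableSpace.generateFrom (posSets (repFun 𝕏 𝕐 T n (𝕏.pp n) (𝕐.pp n))) := by
  induction n with
  | zero =>
    obtain ⟨φ, hφ⟩ := exists_coordEmb S
    let A : Set (S → ℝ) := repFun 𝕏 𝕐 T 0 𝕏.X 𝕐.X
    have hA : ClosedUnderContinuous A := closedUnderContinuous_repFun 𝕏 𝕐 T 0 𝕏.X 𝕐.X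
    have hid : Measurable[MeasurableSpace.generateFrom (posSets A)] (id : S → S) :=
      hφ.measurable_iff.2 fun j => hA.measurable_generateFrom
        ⟨(hφ.continuous j).measurable, ⟨1, hφ.abs_le_one j⟩,
          .base (.ofNormedAddCommGroup (φ j) (hφ.continuous j) 1 (hφ.abs_le_one j)),
          le_rfl, empty_subset _, ae_eq_refl _, ae_eq_refl _⟩
    exact fun s hs => hid hs
  | succ n ih =>
    let A : Set (PredPath (predSpace S n) → ℝ) :=
      repFun 𝕏 𝕐 T ((n : ℕ∞) + 1) (𝕏.ppPath n) (𝕐.ppPath n)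
    have hA : ClosedUnderContinuous A := closedUnderContinuous_repFun _ _ _ _ _ _
    have hid : Measurable[MeasurableSpace.generateFrom (posSets A)]
        (id : PredPath (predSpace S n) → PredPath (predSpace S n)) := by
      refine Measurable.subtype_mk (f := fun z : PredPath (predSpace S n) => z.1)
        (@CadlagPath.measurable_of_eval _ _ _ _ _ _ _ (MeasurableSpace.generateFrom (posSets A))
          _ T hT h1 fun t ht => ?_)
      exact (closedUnderContinuous_repFun _ _ _ _ _ _).measurable_of_integral ih fun G hG =>
        hA.measurable_generateFrom
          (integral_mem_repFun 𝕏 𝕐 hG ht (PredPath.measurable_eval t) (fun _ => rfl) fun _ => rfl)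
    exact fun s hs => hid hs

theorem PredPathInfty.measurable_eval (t : I) (n : ℕ) :
    Measurable fun z : PredPathInfty S => z.1.1 t n :=
  (measurable_pi_apply n).comp ((CadlagPath.measurable_eval t).comp measurable_subtype_coe)

theorem predPathInfty_le_generateFrom (hT : Dense T) (h1 : 1 ∈ T) :
    (inferInstance : MeasurableSpace (PredPathInfty S)) ≤
      MeasurableSpace.generateFrom (posSets (repFun 𝕏 𝕐 T ⊤ 𝕏.ppInfty 𝕐.ppInfty)) := by
  have hA := closedUnderContinuous_repFun 𝕏 𝕐 T ⊤ 𝕏.ppInfty 𝕐.ppInfty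
  have hid : Measurable[MeasurableSpace.generateFrom
      (posSets (repFun 𝕏 𝕐 T ⊤ 𝕏.ppInfty 𝕐.ppInfty))]
      (id : PredPathInfty S → PredPathInfty S) := by
    refine Measurable.subtype_mk (f := fun z : PredPathInfty S => z.1)
      (@CadlagPath.measurable_of_eval _ _ _ _ _ _ _ (MeasurableSpace.generateFrom
        (posSets (repFun 𝕏 𝕐 T ⊤ 𝕏.ppInfty 𝕐.ppInfty))) _ T hT h1 fun t ht => ?_)
    refine @measurable_pi_lambda _ _ _ (MeasurableSpace.generateFrom
      (posSets (repFun 𝕏 𝕐 T ⊤ 𝕏.ppInfty 𝕐.ppInfty))) _ _ fun n => ?_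
    exact (closedUnderContinuous_repFun _ _ _ _ _ _).measurable_of_integral
      (predSpace_le_generateFrom 𝕏 𝕐 hT h1 n) fun G hG =>
        hA.measurable_generateFrom (repFun_mono 𝕏 𝕐 le_top
          (integral_mem_repFun 𝕏 𝕐 hG ht (PredPathInfty.measurable_eval t n) (fun _ => rfl)
            fun _ => rfl))
  exact fun s hs => hid hs

end

/-! ### The process of order `∞` and the equivalence for a fixed set of times. -/

theorem FilteredRV.measurable_ppInfty (𝕏 : FilteredRV.{u, v} S) : Measurable 𝕏.ppInfty :=
  Measurable.subtype_mk (CadlagPath.measurable_of_eval dense_univ (mem_univ _) fun t _ =>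
    measurable_pi_lambda _ fun n => (PredPath.measurable_eval t).comp (𝕏.measurable_pp (n + 1)))

/-- The coordinate `pp^{n+1}` of a path in `M_∞`. -/
def PredPathInfty.proj (n : ℕ) (z : PredPathInfty S) : PredPath (predSpace S n) :=
  ⟨⟨fun t => z.1.1 t n, fun t => ((continuous_apply n).tendsto _).comp (z.1.2.1 t), fun t =>
    let ⟨x, hx⟩ := z.1.2.2 t
    ⟨x n, ((continuous_apply n).tendsto _).comp hx⟩⟩, z.2 n⟩

theorem PredPathInfty.measurable_proj (n : ℕ) : Measurable (PredPathInfty.proj (S := S) n) :=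
  Measurable.subtype_mk (CadlagPath.measurable_of_eval dense_univ (mem_univ _) fun t _ =>
    PredPathInfty.measurable_eval t n)

theorem FilteredRV.ppLaw_eq_iff (n : ℕ∞) (𝕏 : FilteredRV.{u, v} S) (𝕐 : FilteredRV.{u, w} S)
    {T : Set I} (hT : Dense T) (h1 : 1 ∈ T) :
    𝕏.ppLaw n = 𝕐.ppLaw n ↔ ∀ f : AdaptedFun S, (f.rank : ℕ∞) ≤ n → f.times ⊆ T →
      f.expectation 𝕏 = f.expectation 𝕐 := by
  match n with
  | none =>
    refine ⟨fun h f _ _ => ?_, fun h => AdaptedFun.map_eq_of_expectation_eq h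
      𝕏.measurable_ppInfty 𝕐.measurable_ppInfty (predPathInfty_le_generateFrom 𝕏 𝕐 hT h1)⟩
    have h' : 𝕏.P.map 𝕏.ppInfty = 𝕐.P.map 𝕐.ppInfty := h
    have hproj := congrArg (Measure.map (PredPathInfty.proj f.rank)) h'
    rw [Measure.map_map (PredPathInfty.measurable_proj _) 𝕏.measurable_ppInfty,
      Measure.map_map (PredPathInfty.measurable_proj _) 𝕐.measurable_ppInfty] at hproj
    -- Coordinate `n` of `M_∞` carries `pp^{n+1}`; the shift is harmless, since one level above the
    -- rank also determines the expectation.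
    exact AdaptedFun.expectation_eq_of_map_pp_eq (n := f.rank + 1) hproj (Nat.le_succ _)
  | some n =>
    exact ⟨fun h f hf _ => AdaptedFun.expectation_eq_of_map_pp_eq h (Nat.cast_le.1 hf),
      fun h => AdaptedFun.map_eq_of_expectation_eq h (𝕏.measurable_pp n) (𝕐.measurable_pp n)
        (predSpace_le_generateFrom 𝕏 𝕐 hT h1 n)⟩

end Adapted

theorem mainTheorem8 {S : Type u} [TopologicalSpace S] [MeasurableSpace S] [BorelSpace S]
    [LusinSpace S] (n : ℕ∞) (𝕏 : FilteredRV.{u, v} S) (𝕐 : FilteredRV.{u, w} S) :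
    List.TFAE [
      𝕏.ppLaw n = 𝕐.ppLaw n,
      ∀ f : AdaptedFun S, (f.rank : ℕ∞) ≤ n → f.expectation 𝕏 = f.expectation 𝕐,
      ∃ T : Set I, Dense T ∧ 1 ∈ T ∧
        ∀ f : AdaptedFun S, (f.rank : ℕ∞) ≤ n → f.times ⊆ T →
          f.expectation 𝕏 = f.expectation 𝕐] ∧
    ∀ T : Set I, Dense T → 1 ∈ T →
      (𝕏.ppLaw n = 𝕐.ppLaw n ↔
        ∀ f : AdaptedFun S, (f.rank : ℕ∞) ≤ n → f.times ⊆ T →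
          f.expectation 𝕏 = f.expectation 𝕐) := by
  refine ⟨?_, fun T hT h1 => FilteredRV.ppLaw_eq_iff n 𝕏 𝕐 hT h1⟩
  tfae_have 1 → 2 := fun h f hf =>
    (FilteredRV.ppLaw_eq_iff n 𝕏 𝕐 dense_univ (mem_univ _)).1 h f hf (subset_univ _)
  tfae_have 2 → 3 := fun h => ⟨univ, dense_univ, mem_univ _, fun f hf _ => h f hf⟩
  tfae_have 3 → 1 := fun ⟨_, hT, h1, h⟩ => (FilteredRV.ppLaw_eq_iff n 𝕏 𝕐 hT h1).2 h
  tfae_finish
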